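/- Let $M$ be a smooth manifold of dimension $n\ge 2$, let $\alpha(x,y)=\sqrt{a_{ij}(x)y^iy^j}$ be a smooth Riemannian metric on $M$, and let $\beta=b_i(x)y^i$ be a smooth nowhere vanishing 1-form on $M$. Let $F=\alpha^2/\beta$ be the associated Kropina metric, considered on the domain $\{\beta>0\}\subset TM$ (since $n\ge2$, $F$ is automatically non-Riemannian). For a Finsler metric $F$ with fundamental tensor $g_{ij}=\frac12[F^2]_{y^iy^j}$, put $$G^i=\tfrac14 g^{il}\{[F^2]_{x^ky^l}y^k-[F^2]_{x^l}\},\qquad R^i{}_k=2\frac{\partial G^i}{\partial x^k}-\frac{\partial^2G^i}{\partial x^m\partial y^k}y^m+2G^m\frac{\partial^2G^i}{\partial y^m\partial y^k}-\frac{\partial G^i}{\partial y^m}\frac{\partial G^m}{\partial y^k},\qquad \mathrm{Ric}=R^m{}_m .$$ $F$ is called Einstein with Einstein scalar $\sigma$ if $\mathrm{Ric}=\sigma F^2$ on the domain of $F$ for a function $\sigma=\sigma(x)$ on $M$, and Ricci constant if this holds with a constant $\sigma$; the same definitions are applied to the Riemannian metric $\alpha$ on $TM\setminus\{0\}$. With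 $|$ the covariant derivative of the Levi-Civita connection of $\alpha$, put $r_{ij}=\frac12(b_{i|j}+b_{j|i})$, $s_{ij}=\frac12(b_{i|j}-b_{j|i})$, $b^i=a^{ij}b_j$, $s_j=b^is_{ij}$ and $b^2=a^{ij}b_ib_j$. Assume that $\beta$ is a constant Killing form, that is, $r_{ij}=0$ and $s_j=0$ on $M$. Then: 1. $F$ is an Einstein metric if and only if $\alpha$ is an Einstein metric. 2. In this case, if $\sigma$ is the Einstein scalar of $F$ and $\lambda$ that of $\alpha$, then $\sigma=\frac14\lambda b^2\ge0$ on $M$. 3. If $n\ge3$, $M$ is connected and $F$ is Einstein, then $F$ is Ricci constant. -/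

import Mathlib

open scoped Manifold ContDiff Bundle

noncomputable section

namespace Kropina

/-- `ℝⁿ`, the model space of the manifold. -/
abbrev E (n : ℕ) : Type := EuclideanSpace ℝ (Fin n)

/-- The partial derivative `∂f/∂uⁱ` of a function on (an open subset of) `ℝⁿ`. -/
def pd {n : ℕ} (i : Fin n) (f : E n → ℝ) (u : E n) : ℝ :=
  fderiv ℝ f u (EuclideanSpace.single i 1)

/-! ### Finsler geometry in local coordinates

`F u y` is the value of a Finsler function at the point with coordinates `u` on the tangent
vector with components `y`. -/

section Coordinates

variable {n : ℕ}

/-- The square `F²` of a Finsler function. -/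
def sqF (F : E n → E n → ℝ) : E n → E n → ℝ := fun u y => F u y ^ 2

/-- The fundamental tensor `g_{ij} = ½ [F²]_{yⁱ yʲ}`. -/
def fundamentalTensor (F : E n → E n → ℝ) (u y : E n) : Matrix (Fin n) (Fin n) ℝ :=
  Matrix.of fun i j => (1 / 2) * pd i (fun z => pd j (sqF F u) z) y

/-- The geodesic coefficients `Gⁱ = ¼ g^{il} ([F²]_{xᵏ yˡ} yᵏ - [F²]_{xˡ})`. -/
def geodesicCoeff (F : E n → E n → ℝ) (i : Fin n) (u y : E n) : ℝ :=
  (1 / 4) * ∑ l, (fundamentalTensor F u y)⁻¹ i l *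
    ((∑ k, pd k (fun v => pd l (sqF F v) y) u * y k) - pd l (fun v => sqF F v y) u)

/-- The Riemann curvature
`Rⁱ_k = 2 ∂Gⁱ/∂xᵏ - yᵐ ∂²Gⁱ/∂xᵐ∂yᵏ + 2 Gᵐ ∂²Gⁱ/∂yᵐ∂yᵏ - ∂Gⁱ/∂yᵐ ∂Gᵐ/∂yᵏ`. -/
def riemannCurv (F : E n → E n → ℝ) (i k : Fin n) (u y : E n) : ℝ :=
  2 * pd k (fun v => geodesicCoeff F i v y) u
    - ∑ m, pd m (fun v => pd k (geodesicCoeff F i v) y) u * y m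
    + 2 * ∑ m, geodesicCoeff F m u y * pd m (fun z => pd k (geodesicCoeff F i u) z) y
    - ∑ m, pd m (geodesicCoeff F i u) y * pd k (geodesicCoeff F m u) y

/-- The Ricci curvature `Ric = Rᵐ_m`. -/
def ricci (F : E n → E n → ℝ) (u y : E n) : ℝ := ∑ m, riemannCurv F m m u y

/-! ### A Riemannian metric and a 1-form in local coordinates

`A u = (a_{ij}(u))` is the matrix of the metric and `b u = (b_i(u))` the components of the form. -/

/-- The Christoffel symbols `Γᵏ_{ij} = ½ a^{kl} (∂_i a_{lj} + ∂_j a_{li} - ∂_l a_{ij})` of the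
Levi-Civita connection. -/
def christoffel (A : E n → Matrix (Fin n) (Fin n) ℝ) (k i j : Fin n) (u : E n) : ℝ :=
  (1 / 2) * ∑ l, (A u)⁻¹ k l *
    (pd i (fun v => A v l j) u + pd j (fun v => A v l i) u - pd l (fun v => A v i j) u)

/-- The covariant derivative `b_{i|j} = ∂_j b_i - Γᵏ_{ij} b_k`. -/
def covDeriv (A : E n → Matrix (Fin n) (Fin n) ℝ) (b : E n → Fin n → ℝ) (i j : Fin n)
    (u : E n) : ℝ :=
  pd j (fun v => b v i) u - ∑ k, christoffel A k i j u * b u k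

/-- `r_{ij} = ½ (b_{i|j} + b_{j|i})`. -/
def rTensor (A : E n → Matrix (Fin n) (Fin n) ℝ) (b : E n → Fin n → ℝ) (i j : Fin n)
    (u : E n) : ℝ :=
  (1 / 2) * (covDeriv A b i j u + covDeriv A b j i u)

/-- `s_{ij} = ½ (b_{i|j} - b_{j|i})`. -/
def sTensor (A : E n → Matrix (Fin n) (Fin n) ℝ) (b : E n → Fin n → ℝ) (i j : Fin n)
    (u : E n) : ℝ :=
  (1 / 2) * (covDeriv A b i j u - covDeriv A b j i u)

/-- `bⁱ = a^{ij} b_j`. -/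
def raise (A : E n → Matrix (Fin n) (Fin n) ℝ) (b : E n → Fin n → ℝ) (i : Fin n) (u : E n) : ℝ :=
  ∑ j, (A u)⁻¹ i j * b u j

/-- `s_j = bⁱ s_{ij}`. -/
def sForm (A : E n → Matrix (Fin n) (Fin n) ℝ) (b : E n → Fin n → ℝ) (j : Fin n) (u : E n) : ℝ :=
  ∑ i, raise A b i u * sTensor A b i j u

/-- `b² = a^{ij} b_i b_j`. -/
def coordNormSq (A : E n → Matrix (Fin n) (Fin n) ℝ) (b : E n → Fin n → ℝ) (u : E n) : ℝ :=
  ∑ i, raise A b i u * b u i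

end Coordinates

/-! ### Objects on a manifold -/

section Manifold

variable {n : ℕ} {M : Type*} [TopologicalSpace M] [ChartedSpace (E n) M]

/-- The tangent vector at `φ⁻¹(u)` with components `y` in the chart `φ`. -/
def coordVec (φ : OpenPartialHomeomorph M (E n)) (u y : E n) : TangentSpace (𝓡 n) (φ.symm u) :=
  mfderiv (𝓡 n) (𝓡 n) φ.symm u y

/-- The expression in the chart `φ` of a function on the tangent bundle. -/
def inChart (F : ∀ x : M, TangentSpace (𝓡 n) x → ℝ) (φ : OpenPartialHomeomorph M (E n)) :
    E n → E n → ℝ :=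
  fun u y => F (φ.symm u) (coordVec φ u y)

/-- `F`, defined on the (conic, open) domain `D` in the tangent bundle, satisfies
`Ric = σ(x) F²` on `D`. `Ric` does not depend on the local coordinates in which it is computed;
the equation is stated in all smooth charts. -/
def HasEinsteinScalar (F : ∀ x : M, TangentSpace (𝓡 n) x → ℝ)
    (D : ∀ x : M, Set (TangentSpace (𝓡 n) x)) (σ : M → ℝ) : Prop :=
  ∀ φ ∈ IsManifold.maximalAtlas (𝓡 n) ∞ M, ∀ u ∈ φ.target, ∀ y : E n,
    coordVec φ u y ∈ D (φ.symm u) →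
      ricci (inChart F φ) u y = σ (φ.symm u) * inChart F φ u y ^ 2

/-- `F` (on the domain `D`) is an Einstein metric. -/
def IsEinstein (F : ∀ x : M, TangentSpace (𝓡 n) x → ℝ)
    (D : ∀ x : M, Set (TangentSpace (𝓡 n) x)) : Prop :=
  ∃ σ : M → ℝ, HasEinsteinScalar F D σ

/-- `F` (on the domain `D`) is Ricci constant: Einstein with a constant Einstein scalar. -/
def IsRicciConstant (F : ∀ x : M, TangentSpace (𝓡 n) x → ℝ)
    (D : ∀ x : M, Set (TangentSpace (𝓡 n) x)) : Prop :=
  ∃ c : ℝ, HasEinsteinScalar F D (fun _ => c)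

/-- The nonzero tangent vectors: the domain of a Riemannian metric as a Finsler metric. -/
def slit (x : M) : Set (TangentSpace (𝓡 n) x) := {v | v ≠ 0}

variable [IsManifold (𝓡 n) ∞ M]

/-- Smooth (positive definite) Riemannian metrics on `M`. -/
abbrev RMetric (n : ℕ) (M : Type*) [TopologicalSpace M] [ChartedSpace (E n) M]
    [IsManifold (𝓡 n) ∞ M] :=
  Bundle.ContMDiffRiemannianMetric (𝓡 n) ∞ (E n) (fun x : M => TangentSpace (𝓡 n) x)

/-- Smooth 1-forms on `M`. -/
structure OneForm (n : ℕ) (M : Type*) [TopologicalSpace M] [ChartedSpace (E n) M]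
    [IsManifold (𝓡 n) ∞ M] where
  /-- The underlying field of covectors. -/
  toFun (x : M) : TangentSpace (𝓡 n) x →L[ℝ] ℝ
  /-- Smoothness as a section of the cotangent bundle. -/
  contMDiff : ContMDiff (𝓡 n) ((𝓡 n).prod 𝓘(ℝ, E n →L[ℝ] ℝ)) ∞
    (fun x => Bundle.TotalSpace.mk' (E n →L[ℝ] ℝ)
      (E := fun x : M => (TangentSpace (𝓡 n) x →L[ℝ] ℝ)) x (toFun x))

/-- The norm `α(v) = √(a(v, v))`. -/
def alpha (a : RMetric n M) (x : M) (v : TangentSpace (𝓡 n) x) : ℝ := √(a.inner x v v)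

/-- The Kropina metric `F = α² / β`. -/
def kropina (a : RMetric n M) (β : OneForm n M) (x : M) (v : TangentSpace (𝓡 n) x) : ℝ :=
  alpha a x v ^ 2 / β.toFun x v

/-- The domain `β > 0` of the Kropina metric. -/
def posCone (β : OneForm n M) (x : M) : Set (TangentSpace (𝓡 n) x) := {v | 0 < β.toFun x v}

/-- The components `a_{ij}` of the metric in the chart `φ`. -/
def metricMatrix (a : RMetric n M) (φ : OpenPartialHomeomorph M (E n)) (u : E n) :
    Matrix (Fin n) (Fin n) ℝ :=
  Matrix.of fun i j => a.inner (φ.symm u) (coordVec φ u (EuclideanSpace.single i 1))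
    (coordVec φ u (EuclideanSpace.single j 1))

/-- The components `b_i` of the form in the chart `φ`. -/
def formCoeff (β : OneForm n M) (φ : OpenPartialHomeomorph M (E n)) (u : E n) (i : Fin n) : ℝ :=
  β.toFun (φ.symm u) (coordVec φ u (EuclideanSpace.single i 1))

/-- `β` is a constant Killing form: `r_{ij} = 0` and `s_j = 0`. -/
def IsConstantKilling (a : RMetric n M) (β : OneForm n M) : Prop :=
  ∀ φ ∈ IsManifold.maximalAtlas (𝓡 n) ∞ M, ∀ u ∈ φ.target,
    (∀ i j, rTensor (metricMatrix a φ) (formCoeff β φ) i j u = 0) ∧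
    (∀ j, sForm (metricMatrix a φ) (formCoeff β φ) j u = 0)

/-- The function `b² = ‖β_x‖_α² = a^{ij} b_i b_j` on `M` (it does not depend on the local
coordinates; those of the preferred chart at `x` are used). -/
def normSq (a : RMetric n M) (β : OneForm n M) (x : M) : ℝ :=
  coordNormSq (metricMatrix a (chartAt (E n) x)) (formCoeff β (chartAt (E n) x))
    (chartAt (E n) x x)

end Manifold

end Kropina

end

noncomputable section

namespace Kropina

/-! ### Coordinate frames of charts, and smoothness of the coefficients of the metric and the form
-/

section ChartExpressions

variable {n : ℕ} {M : Type*} [TopologicalSpace M] [ChartedSpace (E n) M]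

/-! Write s^i_j for b^i_{|j}, an index 0 for contraction with y, and b♯ for the vector b^i. For a
constant Killing form, s^i_0 is α-orthogonal to y and annihilated by β, and this makes the sprays
differ by a single term: G^i = ½ Γ^i_00 − ½ F s^i_0 (`geodesicCoeff_kropina`). The extra term has
zero divergence in y, so it enters the Ricci curvature only through its x-divergence and through the
product ∂G^i/∂y^k · ∂G^k/∂y^i (`ricci_eq_of_spray`). Two identities, s^k_{j|k} = Ric_{jp} b^p
(`div_raisedCovDeriv`) and −s^k_m s^m_k = Ric(b♯, b♯) (`ricci_raise_raise`), turn what remains into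
Ric_F(y) = Ric_α(y − (F(y)/2) b♯), which is `ricci_kropina`.

The rest is a navigation picture. Because α² = Fβ, the vector z = y − (F/2) b♯ satisfies α²(z) = F²
b²/4 (`quad_indicatrix`). Hence Ric_α = λ α² at z is the same equation as Ric_F = (λ b²/4) F² at y.
Every nonzero z with β(z) ≥ 0 arises from some y in the cone (`exists_indicatrix`), and quadratic
forms are even, so an Einstein equation for F determines Ric_α on all vectors
(`quad_eq_of_kropina_einstein`).

The sign comes from λ b² = Ric(b♯, b♯) = −s^k_m s^m_k, a squared norm because s is antisymmetric
(`ricci_raise_raise_nonneg`). For the constancy of σ = λ b²/4, Schur's lemma gives dλ = 0 when n ≥ 3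
(`pd_einsteinScalar`), and b² has zero derivative because b^i b_{i|j} = s_j = 0 (`pd_coordNormSq`);
connectedness does the rest. -/

theorem coordVec_linear (φ : OpenPartialHomeomorph M (E n)) (u y : E n) :
    coordVec φ u y = ∑ i, y i • coordVec φ u (EuclideanSpace.single i 1) := by
  have h : y = ∑ i, y i • EuclideanSpace.single i (1 : ℝ) := by
    ext j
    simp [Finset.sum_apply, Pi.single_apply]
  let L : E n →L[ℝ] E n := mfderiv (𝓡 n) (𝓡 n) φ.symm u
  have hL : L y = ∑ i, y i • L (EuclideanSpace.single i 1) := by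
    conv_lhs => rw [h]
    rw [map_sum]
    simp only [map_smul]
  exact hL

theorem mdifferentiableAt_chart_symm {φ : OpenPartialHomeomorph M (E n)}
    (hφ : φ ∈ IsManifold.maximalAtlas (𝓡 n) ∞ M) {u : E n} (hu : u ∈ φ.target) :
    MDifferentiableAt (𝓡 n) (𝓡 n) φ.symm u :=
  (contMDiffAt_symm_of_mem_maximalAtlas hφ hu).mdifferentiableAt (by simp)

theorem mdifferentiableAt_chart {φ : OpenPartialHomeomorph M (E n)}
    (hφ : φ ∈ IsManifold.maximalAtlas (𝓡 n) ∞ M) {x : M} (hx : x ∈ φ.source) :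
    MDifferentiableAt (𝓡 n) (𝓡 n) φ x :=
  (contMDiffAt_of_mem_maximalAtlas hφ hx).mdifferentiableAt (by simp)

theorem coordVec_injective {φ : OpenPartialHomeomorph M (E n)}
    (hφ : φ ∈ IsManifold.maximalAtlas (𝓡 n) ∞ M) {u : E n} (hu : u ∈ φ.target) :
    Function.Injective (coordVec φ u) := by
  have h1 := mfderiv_comp u (mdifferentiableAt_chart hφ (φ.map_target hu))
    (mdifferentiableAt_chart_symm hφ hu)
  have h2 : mfderiv (𝓡 n) (𝓡 n) (φ ∘ φ.symm) u = mfderiv (𝓡 n) (𝓡 n) id u := by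
    apply Filter.EventuallyEq.mfderiv_eq
    filter_upwards [φ.open_target.mem_nhds hu] with v hv
    simp [φ.right_inv hv]
  rw [h2, mfderiv_id] at h1
  intro y z hyz
  have e1 := congrArg (mfderiv (𝓡 n) (𝓡 n) φ (φ.symm u)) hyz
  have e2 := fun w : E n => DFunLike.congr_fun h1 w
  have := (e2 y).trans (Eq.trans e1 (e2 z).symm)
  exact this

theorem coordVec_surjective {φ : OpenPartialHomeomorph M (E n)}
    (hφ : φ ∈ IsManifold.maximalAtlas (𝓡 n) ∞ M) {u : E n} (hu : u ∈ φ.target) :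
    Function.Surjective (coordVec φ u) := by
  have h := coordVec_injective hφ hu
  let L : E n →L[ℝ] E n := mfderiv (𝓡 n) (𝓡 n) φ.symm u
  exact (LinearMap.injective_iff_surjective (f := L.toLinearMap)).1 h

variable [IsManifold (𝓡 n) ∞ M]

/-- A coordinate field is the tangent map of `φ.symm` composed with the constant section u ↦ (u, y),
so it inherits the smoothness of both. -/
theorem contMDiffOn_coordVec {φ : OpenPartialHomeomorph M (E n)}
    (hφ : φ ∈ IsManifold.maximalAtlas (𝓡 n) ∞ M) (y : E n) :
    ContMDiffOn (𝓡 n) ((𝓡 n).prod 𝓘(ℝ, E n)) ∞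
      (fun u => Bundle.TotalSpace.mk' (E n) (E := fun x : M => TangentSpace (𝓡 n) x)
        (φ.symm u) (coordVec φ u y)) φ.target := by
  have h1 := (contMDiffOn_symm_of_mem_maximalAtlas hφ).contMDiffOn_tangentMapWithin (m := ∞)
    (by simp) φ.open_target.uniqueMDiffOn
  have h2 : ContMDiffOn (𝓡 n) ((𝓡 n).prod 𝓘(ℝ, E n)) ∞
      (fun u : E n => (⟨u, y⟩ : TangentBundle (𝓡 n) (E n))) φ.target := by
    intro v hv
    rw [Bundle.contMDiffWithinAt_totalSpace]
    refine ⟨contMDiffWithinAt_id, ?_⟩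
    refine (contMDiffWithinAt_const (c := y)).congr ?_ ?_ <;> simp
  refine (h1.comp h2 (fun v hv => hv)).congr ?_
  intro v hv
  simp only [Function.comp, tangentMapWithin, coordVec]
  rw [mfderivWithin_of_isOpen φ.open_target hv]

theorem contDiffOn_metricMatrix (a : RMetric n M) {φ : OpenPartialHomeomorph M (E n)}
    (hφ : φ ∈ IsManifold.maximalAtlas (𝓡 n) ∞ M) (i j : Fin n) :
    ContDiffOn ℝ ∞ (fun u => metricMatrix a φ u i j) φ.target := by
  let : Bundle.RiemannianBundle (fun x : M => TangentSpace (𝓡 n) x) := ⟨a.toRiemannianMetric⟩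
  rw [← contMDiffOn_iff_contDiffOn]
  exact ContMDiffOn.inner_bundle (IB := 𝓡 n) (contMDiffOn_coordVec hφ (EuclideanSpace.single i 1))
    (contMDiffOn_coordVec hφ (EuclideanSpace.single j 1))

theorem contDiffOn_formCoeff (β : OneForm n M) {φ : OpenPartialHomeomorph M (E n)}
    (hφ : φ ∈ IsManifold.maximalAtlas (𝓡 n) ∞ M) (i : Fin n) :
    ContDiffOn ℝ ∞ (fun u => formCoeff β φ u i) φ.target := by
  rw [← contMDiffOn_iff_contDiffOn]
  have h : ContMDiffOn (𝓡 n) ((𝓡 n).prod 𝓘(ℝ)) ∞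
      (fun u ↦ Bundle.TotalSpace.mk' ℝ (E := Bundle.Trivial M ℝ) (φ.symm u)
        (β.toFun (φ.symm u) (coordVec φ u (EuclideanSpace.single i 1)))) φ.target := by
    apply ContMDiffOn.clm_bundle_apply (F₁ := E n)
    · exact β.contMDiff.comp_contMDiffOn (contMDiffOn_symm_of_mem_maximalAtlas hφ)
    · exact contMDiffOn_coordVec hφ (EuclideanSpace.single i 1)
  exact fun u hu => (Bundle.contMDiffWithinAt_totalSpace.1 (h u hu)).2

end ChartExpressions

/-! ### Calculus of partial derivatives -/

section PartialDerivatives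

variable {n : ℕ}

/-- `f` is differentiable at `u` and its `i`-th partial derivative there is `d`. -/
def HasPd (i : Fin n) (f : E n → ℝ) (d : ℝ) (u : E n) : Prop :=
  DifferentiableAt ℝ f u ∧ pd i f u = d

variable {i : Fin n} {f g : E n → ℝ} {d e : ℝ} {u : E n}

theorem _root_.DifferentiableAt.hasPd (h : DifferentiableAt ℝ f u) (i : Fin n) :
    HasPd i f (pd i f u) u := ⟨h, rfl⟩

theorem HasPd.congr_deriv (h : HasPd i f d u) (hd : d = e) : HasPd i f e u := hd ▸ h

theorem pd_congr (h : f =ᶠ[nhds u] g) : pd i f u = pd i g u := by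
  simp only [pd, h.fderiv_eq]

theorem hasPd_const (c : ℝ) : HasPd i (fun _ => c) 0 u :=
  ⟨differentiableAt_const c, by simp [pd]⟩

theorem hasPd_coord (j : Fin n) : HasPd i (fun y => y j) (if j = i then 1 else 0) u := by
  have h : HasFDerivAt (fun y : E n => y j) (EuclideanSpace.proj j : E n →L[ℝ] ℝ) u :=
    (EuclideanSpace.proj j : E n →L[ℝ] ℝ).hasFDerivAt
  exact ⟨h.differentiableAt, by rw [pd, h.fderiv]; simp⟩

theorem HasPd.add (hf : HasPd i f d u) (hg : HasPd i g e u) :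
    HasPd i (fun v => f v + g v) (d + e) u :=
  ⟨hf.1.add hg.1, by rw [pd, fderiv_fun_add hf.1 hg.1, ← hf.2, ← hg.2]; rfl⟩

theorem HasPd.sub (hf : HasPd i f d u) (hg : HasPd i g e u) :
    HasPd i (fun v => f v - g v) (d - e) u :=
  ⟨hf.1.sub hg.1, by rw [pd, fderiv_fun_sub hf.1 hg.1, ← hf.2, ← hg.2]; rfl⟩

theorem HasPd.mul (hf : HasPd i f d u) (hg : HasPd i g e u) :
    HasPd i (fun v => f v * g v) (d * g u + f u * e) u :=
  ⟨hf.1.mul hg.1, by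
    rw [pd, fderiv_fun_mul hf.1 hg.1, ← hf.2, ← hg.2]
    simp only [add_apply, smul_apply, smul_eq_mul, pd]
    ring⟩

theorem HasPd.const_mul (c : ℝ) (hf : HasPd i f d u) : HasPd i (fun v => c * f v) (c * d) u :=
  ((hasPd_const c).mul hf).congr_deriv (by ring)

theorem HasPd.inv (hf : HasPd i f d u) (h0 : f u ≠ 0) :
    HasPd i (fun v => (f v)⁻¹) (-d / f u ^ 2) u := by
  have h : HasFDerivAt (fun v => (f v)⁻¹) (-(f u ^ 2)⁻¹ • fderiv ℝ f u) u :=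
    (hasDerivAt_inv h0).comp_hasFDerivAt u hf.1.hasFDerivAt
  refine ⟨h.differentiableAt, ?_⟩
  rw [pd, h.fderiv, ← hf.2]
  simp only [smul_apply, smul_eq_mul, pd]
  ring

theorem HasPd.div (hf : HasPd i f d u) (hg : HasPd i g e u) (h0 : g u ≠ 0) :
    HasPd i (fun v => f v / g v) ((d * g u - f u * e) / g u ^ 2) u := by
  simp only [div_eq_mul_inv (f _)]
  exact (hf.mul (hg.inv h0)).congr_deriv (by field_simp; ring)

theorem HasPd.sum {ι : Type*} {s : Finset ι} {f : ι → E n → ℝ} {d : ι → ℝ}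
    (h : ∀ k ∈ s, HasPd i (f k) (d k) u) : HasPd i (fun v => ∑ k ∈ s, f k v) (∑ k ∈ s, d k) u := by
  classical
  induction s using Finset.induction_on with
  | empty => simpa using hasPd_const (i := i) (u := u) 0
  | insert a s ha ih =>
    simp only [Finset.sum_insert ha]
    exact (h a (Finset.mem_insert_self _ _)).add
      (ih fun k hk => h k (Finset.mem_insert_of_mem hk))

theorem hasPd_linear (c : Fin n → ℝ) : HasPd i (fun y => ∑ j, c j * y j) (c i) u :=
  (HasPd.sum fun j _ => (hasPd_coord j).const_mul (c j)).congr_deriv (by simp)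

variable {U : Set (E n)}

theorem hasPd_of_contDiffOn (hU : IsOpen U) (hf : ContDiffOn ℝ ∞ f U) (hu : u ∈ U) (i : Fin n) :
    HasPd i f (pd i f u) u :=
  ((hf.contDiffAt (hU.mem_nhds hu)).differentiableAt (by simp)).hasPd i

theorem differentiableAt_of_contDiffOn (hU : IsOpen U) (hf : ContDiffOn ℝ ∞ f U) (hu : u ∈ U) :
    DifferentiableAt ℝ f u :=
  (hf.contDiffAt (hU.mem_nhds hu)).differentiableAt (by simp)

theorem contDiffOn_pd (hU : IsOpen U) (hf : ContDiffOn ℝ ∞ f U) (i : Fin n) :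
    ContDiffOn ℝ ∞ (pd i f) U :=
  (hf.fderiv_of_isOpen hU (m := ∞) (by simp)).clm_apply contDiffOn_const

theorem pd_comm (hU : IsOpen U) (hf : ContDiffOn ℝ ∞ f U) (hu : u ∈ U) (i j : Fin n) :
    pd i (pd j f) u = pd j (pd i f) u := by
  have hc := hf.contDiffAt (hU.mem_nhds hu)
  have hs : IsSymmSndFDerivAt ℝ f u := hc.isSymmSndFDerivAt (by simpa using ENat.LEInfty.out)
  have hd : DifferentiableAt ℝ (fderiv ℝ f) u :=
    ((hf.fderiv_of_isOpen hU (m := ∞) (by simp)).contDiffAt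
      (hU.mem_nhds hu)).differentiableAt (by simp)
  have h (k l : Fin n) : pd k (pd l f) u =
      fderiv ℝ (fderiv ℝ f) u (EuclideanSpace.single k 1) (EuclideanSpace.single l 1) := by
    change fderiv ℝ (fun v => fderiv ℝ f v (EuclideanSpace.single l 1)) u _ = _
    rw [fderiv_clm_apply hd (differentiableAt_const _)]
    simp
  rw [h, h, hs.eq]

theorem contDiffOn_det {A : E n → Matrix (Fin n) (Fin n) ℝ}
    (hA : ∀ i j, ContDiffOn ℝ ∞ (fun u => A u i j) U) :
    ContDiffOn ℝ ∞ (fun u => (A u).det) U := by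
  simp only [Matrix.det_apply']
  exact ContDiffOn.sum fun σ _ => contDiffOn_const.mul (contDiffOn_prod fun i _ => hA _ _)

/-- Cramer's rule: the entries of the inverse are determinants, hence polynomials in the entries,
divided by the nonvanishing determinant. -/
theorem contDiffOn_inv {A : E n → Matrix (Fin n) (Fin n) ℝ}
    (hA : ∀ i j, ContDiffOn ℝ ∞ (fun u => A u i j) U) (h0 : ∀ u ∈ U, (A u).det ≠ 0)
    (i j : Fin n) : ContDiffOn ℝ ∞ (fun u => (A u)⁻¹ i j) U := by
  simp only [Matrix.inv_def, Matrix.smul_apply, Ring.inverse_eq_inv', smul_eq_mul,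
    Matrix.adjugate_apply]
  refine ((contDiffOn_det hA).inv h0).mul (contDiffOn_det fun k l => ?_)
  by_cases hk : k = j
  · subst hk
    simpa using contDiffOn_const
  · simpa [Matrix.updateRow_ne hk] using hA k l

/-- The entrywise partial derivative of a matrix-valued function. -/
def mpd (i : Fin n) (N : E n → Matrix (Fin n) (Fin n) ℝ) (u : E n) : Matrix (Fin n) (Fin n) ℝ :=
  Matrix.of fun k l => pd i (fun v => N v k l) u

theorem mpd_congr {N P : E n → Matrix (Fin n) (Fin n) ℝ} (h : N =ᶠ[nhds u] P) :
    mpd i N u = mpd i P u := by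
  ext k l
  exact pd_congr (h.mono fun v hv => by simp only [hv])

theorem mpd_add {N P : E n → Matrix (Fin n) (Fin n) ℝ}
    (hN : ∀ k l, DifferentiableAt ℝ (fun v => N v k l) u)
    (hP : ∀ k l, DifferentiableAt ℝ (fun v => P v k l) u) :
    mpd i (fun v => N v + P v) u = mpd i N u + mpd i P u := by
  ext k l
  exact (((hN k l).hasPd i).add ((hP k l).hasPd i)).2

theorem mpd_sub {N P : E n → Matrix (Fin n) (Fin n) ℝ}
    (hN : ∀ k l, DifferentiableAt ℝ (fun v => N v k l) u)
    (hP : ∀ k l, DifferentiableAt ℝ (fun v => P v k l) u) :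
    mpd i (fun v => N v - P v) u = mpd i N u - mpd i P u := by
  ext k l
  exact (((hN k l).hasPd i).sub ((hP k l).hasPd i)).2

theorem mpd_mul {N P : E n → Matrix (Fin n) (Fin n) ℝ}
    (hN : ∀ k l, DifferentiableAt ℝ (fun v => N v k l) u)
    (hP : ∀ k l, DifferentiableAt ℝ (fun v => P v k l) u) :
    mpd i (fun v => N v * P v) u = mpd i N u * P u + N u * mpd i P u := by
  ext k l
  simp only [Matrix.add_apply, Matrix.mul_apply, ← Finset.sum_add_distrib]
  change pd i (fun v => (N v * P v) k l) u = _
  simp only [Matrix.mul_apply]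
  exact (HasPd.sum fun m _ => ((hN k m).hasPd i).mul ((hP m l).hasPd i)).2

theorem mpd_transpose {N : E n → Matrix (Fin n) (Fin n) ℝ} :
    mpd i (fun v => (N v).transpose) u = (mpd i N u).transpose := rfl

theorem contDiffOn_mul_apply {N P : E n → Matrix (Fin n) (Fin n) ℝ}
    (hN : ∀ k l, ContDiffOn ℝ ∞ (fun v => N v k l) U)
    (hP : ∀ k l, ContDiffOn ℝ ∞ (fun v => P v k l) U) (k l : Fin n) :
    ContDiffOn ℝ ∞ (fun v => (N v * P v) k l) U := by
  simp only [Matrix.mul_apply]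
  exact ContDiffOn.sum fun m _ => (hN k m).mul (hP m l)

end PartialDerivatives

/-! ### Riemannian geometry in local coordinates -/

section Riemannian

variable {n : ℕ}

/-- `A` is a smooth Riemannian metric on the open set `U`. -/
structure MetricOn (U : Set (E n)) (A : E n → Matrix (Fin n) (Fin n) ℝ) : Prop where
  isOpen : IsOpen U
  smooth : ∀ i j, ContDiffOn ℝ ∞ (fun u => A u i j) U
  posDef : ∀ u ∈ U, (A u).PosDef

/-- The connection matrices `(Γ_k)ⁱ_j = Γⁱ_{kj}`. -/
def connection (A : E n → Matrix (Fin n) (Fin n) ℝ) (k : Fin n) (u : E n) :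
    Matrix (Fin n) (Fin n) ℝ :=
  Matrix.of fun i j => christoffel A i k j u

/-- The curvature matrices `R_{kl} = ∂_k Γ_l - ∂_l Γ_k + Γ_k Γ_l - Γ_l Γ_k`. -/
def curvature (A : E n → Matrix (Fin n) (Fin n) ℝ) (k l : Fin n) (u : E n) :
    Matrix (Fin n) (Fin n) ℝ :=
  mpd k (connection A l) u - mpd l (connection A k) u +
    (connection A k u * connection A l u - connection A l u * connection A k u)

/-- The Ricci tensor. -/
def ricciTensor (A : E n → Matrix (Fin n) (Fin n) ℝ) (j p : Fin n) (u : E n) : ℝ :=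
  ∑ k, curvature A k j u k p

variable {U : Set (E n)} {A : E n → Matrix (Fin n) (Fin n) ℝ} {u : E n}

theorem curvature_swap (k l : Fin n) : curvature A l k u = -curvature A k l u := by
  simp only [curvature]
  abel

namespace MetricOn

variable (h : MetricOn U A)

include h

theorem transpose_eq (hu : u ∈ U) : (A u).transpose = A u := (h.posDef u hu).1

theorem symm_apply (hu : u ∈ U) (i j : Fin n) : A u i j = A u j i :=
  congrFun (congrFun (h.transpose_eq hu) j) i

theorem det_ne_zero (hu : u ∈ U) : (A u).det ≠ 0 := (h.posDef u hu).det_pos.ne'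

theorem mul_inv (hu : u ∈ U) : A u * (A u)⁻¹ = 1 :=
  Matrix.mul_nonsing_inv _ (h.det_ne_zero hu).isUnit

theorem inv_mul (hu : u ∈ U) : (A u)⁻¹ * A u = 1 :=
  Matrix.nonsing_inv_mul _ (h.det_ne_zero hu).isUnit

theorem inv_transpose (hu : u ∈ U) : ((A u)⁻¹).transpose = (A u)⁻¹ := by
  rw [Matrix.transpose_nonsing_inv, h.transpose_eq hu]

theorem smooth_inv (i j : Fin n) : ContDiffOn ℝ ∞ (fun u => (A u)⁻¹ i j) U :=
  contDiffOn_inv h.smooth (fun _ hu => h.det_ne_zero hu) i j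

theorem pd_symm (hu : u ∈ U) (k i j : Fin n) :
    pd k (fun v => A v i j) u = pd k (fun v => A v j i) u :=
  pd_congr ((h.isOpen.mem_nhds hu) |> Filter.mem_of_superset <| fun _ hv => h.symm_apply hv i j)

theorem christoffel_symm (hu : u ∈ U) (k i j : Fin n) :
    christoffel A k i j u = christoffel A k j i u := by
  simp only [christoffel]
  congr 1
  refine Finset.sum_congr rfl fun l _ => ?_
  rw [h.pd_symm hu l i j]
  ring

theorem smooth_christoffel (k i j : Fin n) : ContDiffOn ℝ ∞ (christoffel A k i j) U :=
  contDiffOn_const.mul (ContDiffOn.sum fun l _ => (h.smooth_inv k l).mul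
    (((contDiffOn_pd h.isOpen (h.smooth l j) i).add
      (contDiffOn_pd h.isOpen (h.smooth l i) j)).sub (contDiffOn_pd h.isOpen (h.smooth i j) l)))

theorem smooth_connection (k i j : Fin n) :
    ContDiffOn ℝ ∞ (fun u => connection A k u i j) U :=
  h.smooth_christoffel i k j

theorem lower_christoffel (hu : u ∈ U) (m i j : Fin n) :
    ∑ k, A u m k * christoffel A k i j u = (1 / 2) * (pd i (fun v => A v m j) u +
      pd j (fun v => A v m i) u - pd m (fun v => A v i j) u) := by
  set X : Fin n → ℝ := fun l => pd i (fun v => A v l j) u +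
      pd j (fun v => A v l i) u - pd l (fun v => A v i j) u with hX
  have h1 : (A u).mulVec ((A u)⁻¹.mulVec X) m = X m := by
    rw [Matrix.mulVec_mulVec, h.mul_inv hu, Matrix.one_mulVec]
  change _ = (1 / 2) * X m
  rw [← h1]
  simp only [Matrix.mulVec, dotProduct, christoffel, Finset.mul_sum, hX]
  refine Finset.sum_congr rfl fun k _ => Finset.sum_congr rfl fun l _ => ?_
  ring

/-- This is ∇a = 0: adding the two lowered Christoffel symbols with i and j exchanged leaves exactly
one derivative of the metric. -/
theorem pd_metric (hu : u ∈ U) (k i j : Fin n) :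
    pd k (fun v => A v i j) u =
      ∑ p, (christoffel A p k i u * A u p j + A u i p * christoffel A p k j u) := by
  have h1 := h.lower_christoffel hu j k i
  have h2 := h.lower_christoffel hu i k j
  have e : ∑ p, christoffel A p k i u * A u p j = ∑ p, A u j p * christoffel A p k i u :=
    Finset.sum_congr rfl fun p _ => by rw [h.symm_apply hu p j]; ring
  rw [Finset.sum_add_distrib, e, h1, h2, h.pd_symm hu k j i, h.pd_symm hu i k j,
    h.pd_symm hu j k i]
  ring

theorem mpd_metric (hu : u ∈ U) (k : Fin n) :
    mpd k A u = (connection A k u).transpose * A u + A u * connection A k u := by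
  ext i j
  simp only [mpd, Matrix.of_apply, h.pd_metric hu, Matrix.add_apply, Matrix.mul_apply,
    Matrix.transpose_apply, connection, Finset.sum_add_distrib]

/-- Differentiating ∂_k A = Γ_kᵀ A + A Γ_k once more and using equality of mixed partials of A
leaves precisely the curvature terms. -/
theorem curvature_antisymm (hu : u ∈ U) (k l : Fin n) :
    (curvature A k l u).transpose * A u + A u * curvature A k l u = 0 := by
  have dA : ∀ i j, DifferentiableAt ℝ (fun v => A v i j) u := fun i j =>
    differentiableAt_of_contDiffOn h.isOpen (h.smooth i j) hu
  have dG : ∀ k i j, DifferentiableAt ℝ (fun v => connection A k v i j) u := fun k i j =>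
    differentiableAt_of_contDiffOn h.isOpen (h.smooth_connection k i j) hu
  have key : ∀ k l, mpd l (mpd k A) u = (mpd l (connection A k) u).transpose * A u +
      (connection A k u).transpose * ((connection A l u).transpose * A u + A u * connection A l u) +
      (((connection A l u).transpose * A u + A u * connection A l u) * connection A k u +
        A u * mpd l (connection A k) u) := by
    intro k l
    rw [mpd_congr (P := fun v => (connection A k v).transpose * A v + A v * connection A k v)
      (Filter.mem_of_superset (h.isOpen.mem_nhds hu) fun v hv => h.mpd_metric hv k)]
    have s1 : ∀ i j, DifferentiableAt ℝ
        (fun v => ((connection A k v).transpose * A v) i j) u := fun i j =>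
      differentiableAt_of_contDiffOn h.isOpen (contDiffOn_mul_apply
        (N := fun v => (connection A k v).transpose)
        (fun i j => h.smooth_connection k j i) h.smooth i j) hu
    have s2 : ∀ i j, DifferentiableAt ℝ (fun v => (A v * connection A k v) i j) u := fun i j =>
      differentiableAt_of_contDiffOn h.isOpen (contDiffOn_mul_apply h.smooth
        (h.smooth_connection k) i j) hu
    rw [mpd_add s1 s2, mpd_mul (N := fun v => (connection A k v).transpose)
      (fun i j => dG k j i) dA, mpd_mul dA (dG k), mpd_transpose, h.mpd_metric hu l]
  have hs : mpd l (mpd k A) u = mpd k (mpd l A) u := by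
    ext i j
    exact pd_comm h.isOpen (h.smooth i j) hu l k
  rw [key, key] at hs
  have := sub_eq_zero.2 hs.symm
  simp only [curvature, Matrix.transpose_add, Matrix.transpose_sub, Matrix.transpose_mul]
  rw [← this]
  noncomm_ring

/-- Conjugation by A turns R into −Rᵀ, which has the opposite trace. -/
theorem trace_curvature (hu : u ∈ U) (k l : Fin n) : (curvature A k l u).trace = 0 := by
  have h1 := h.curvature_antisymm hu k l
  have h2 := congrArg (fun N => (N * (A u)⁻¹).trace) h1
  simp only [Matrix.add_mul, Matrix.mul_assoc, h.mul_inv hu, Matrix.trace_add, Matrix.zero_mul,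
    Matrix.trace_zero, Matrix.mul_one, Matrix.trace_transpose] at h2
  rw [Matrix.trace_mul_comm, Matrix.mul_assoc, h.inv_mul hu, Matrix.mul_one] at h2
  linarith

/-- Only the symmetry of Γ in its lower indices is needed: after it is applied, the derivatives and
the products cancel in pairs. -/
theorem first_bianchi (hu : u ∈ U) (i j k l : Fin n) :
    curvature A k l u i j + curvature A l j u i k + curvature A j k u i l = 0 := by
  have c : ∀ m a b c, pd m (fun v => christoffel A a b c v) u =
      pd m (fun v => christoffel A a c b v) u := fun m a b c =>
    pd_congr (Filter.mem_of_superset (h.isOpen.mem_nhds hu) fun v hv => h.christoffel_symm hv a b c)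
  simp only [curvature, Matrix.add_apply, Matrix.sub_apply, mpd, Matrix.of_apply, connection,
    Matrix.mul_apply]
  rw [c k i l j, c l i k j, c j i k l]
  have e : ∀ a b c, ∑ x, christoffel A i a x u * christoffel A x b c u =
      ∑ x, christoffel A i a x u * christoffel A x c b u := fun a b c =>
    Finset.sum_congr rfl fun x _ => by rw [h.christoffel_symm hu x b c]
  rw [e k l j, e l k j, e j l k]
  ring

/-- The first Bianchi identity contracted on its upper index gives the antisymmetric part of Ricci
as a trace of R_{jp}, which vanishes. -/
theorem ricciTensor_symm (hu : u ∈ U) (j p : Fin n) :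
    ricciTensor A j p u = ricciTensor A p j u := by
  have h1 : ∑ k, curvature A j p u k k = 0 := h.trace_curvature hu j p
  have h2 : ∑ k, (curvature A k j u k p + curvature A j p u k k + curvature A p k u k j) = 0 :=
    Finset.sum_eq_zero fun k _ => h.first_bianchi hu k p k j
  simp only [Finset.sum_add_distrib, h1] at h2
  simp only [ricciTensor]
  have h3 : ∑ k, curvature A p k u k j = - ∑ k, curvature A k p u k j := by
    rw [← Finset.sum_neg_distrib]
    exact Finset.sum_congr rfl fun k _ => by rw [curvature_swap k p]; rfl
  rw [h3] at h2
  linarith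

theorem smooth_curvature (k l i j : Fin n) :
    ContDiffOn ℝ ∞ (fun v => curvature A k l v i j) U := by
  simp only [curvature, Matrix.add_apply, Matrix.sub_apply]
  exact ((contDiffOn_pd h.isOpen (h.smooth_connection l i j) k).sub
    (contDiffOn_pd h.isOpen (h.smooth_connection k i j) l)).add
    ((contDiffOn_mul_apply (h.smooth_connection k) (h.smooth_connection l) i j).sub
    (contDiffOn_mul_apply (h.smooth_connection l) (h.smooth_connection k) i j))

/-- The second derivatives of Γ cancel by equality of mixed partials; the terms linear in ∂Γ and
cubic in Γ cancel as in the Jacobi identity. Each summand is the covariant derivative in the matrix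
indices alone. -/
theorem second_bianchi (hu : u ∈ U) (k l m : Fin n) :
    (mpd m (curvature A k l) u + connection A m u * curvature A k l u
        - curvature A k l u * connection A m u) +
      (mpd k (curvature A l m) u + connection A k u * curvature A l m u
        - curvature A l m u * connection A k u) +
      (mpd l (curvature A m k) u + connection A l u * curvature A m k u
        - curvature A m k u * connection A l u) = 0 := by
  have key : ∀ k l m, mpd m (curvature A k l) u =
      mpd m (mpd k (connection A l)) u - mpd m (mpd l (connection A k)) u +
      ((mpd m (connection A k) u * connection A l u + connection A k u * mpd m (connection A l) u) -
      (mpd m (connection A l) u * connection A k u +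
        connection A l u * mpd m (connection A k) u)) := by
    intro k l m
    have d := fun {f : E n → ℝ} (hf : ContDiffOn ℝ ∞ f U) =>
      differentiableAt_of_contDiffOn h.isOpen hf hu
    have d1 := fun k i j => d (h.smooth_connection k i j)
    have d2 := fun k l i j => d (contDiffOn_pd h.isOpen (h.smooth_connection k i j) l)
    have d3 := fun k l i j => d (contDiffOn_mul_apply (h.smooth_connection k)
      (h.smooth_connection l) i j)
    have e : curvature A k l = fun v => (mpd k (connection A l) v - mpd l (connection A k) v) +
      (connection A k v * connection A l v - connection A l v * connection A k v) := rfl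
    rw [e, mpd_add (N := fun v => mpd k (connection A l) v - mpd l (connection A k) v)
      (P := fun v => connection A k v * connection A l v - connection A l v * connection A k v)
      (fun i j => (d2 l k i j).sub (d2 k l i j)) (fun i j => (d3 k l i j).sub (d3 l k i j)),
      mpd_sub (N := mpd k (connection A l)) (P := mpd l (connection A k)) (d2 l k) (d2 k l),
      mpd_sub (d3 k l) (d3 l k), mpd_mul (d1 k) (d1 l), mpd_mul (d1 l) (d1 k)]
  have hs : ∀ k l m, mpd l (mpd k (connection A m)) u = mpd k (mpd l (connection A m)) u := by
    intro k l m
    ext i j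
    exact pd_comm h.isOpen (h.smooth_connection m i j) hu l k
  rw [key, key, key, hs k m l, hs l m k, hs l k m]
  simp only [curvature]
  noncomm_ring

end MetricOn

end Riemannian

/-! ### Schur's lemma from the contracted second Bianchi identity -/

section Schur

variable {n : ℕ}

/-- The curvature matrices with the second index raised, `R_{kl} A⁻¹`. -/
def raisedCurvature (A : E n → Matrix (Fin n) (Fin n) ℝ) (k l : Fin n) (u : E n) :
    Matrix (Fin n) (Fin n) ℝ :=
  curvature A k l u * (A u)⁻¹

/-- The covariant derivative of the raised curvature in its matrix indices. -/
def raisedCurvatureDeriv (A : E n → Matrix (Fin n) (Fin n) ℝ) (m k l : Fin n) (u : E n) :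
    Matrix (Fin n) (Fin n) ℝ :=
  mpd m (raisedCurvature A k l) u + connection A m u * raisedCurvature A k l u +
    raisedCurvature A k l u * (connection A m u).transpose

variable {U : Set (E n)} {A : E n → Matrix (Fin n) (Fin n) ℝ} {u : E n}

theorem raisedCurvature_swap (k l : Fin n) :
    raisedCurvature A l k u = -raisedCurvature A k l u := by
  rw [raisedCurvature, curvature_swap k l, Matrix.neg_mul, raisedCurvature]

theorem raisedCurvatureDeriv_swap (m k l : Fin n) :
    raisedCurvatureDeriv A m l k u = -raisedCurvatureDeriv A m k l u := by
  have h : mpd m (raisedCurvature A l k) u = -mpd m (raisedCurvature A k l) u := by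
    ext i j
    have e : (fun v => raisedCurvature A l k v i j) = fun v => -raisedCurvature A k l v i j := by
      funext v
      rw [raisedCurvature_swap k l]
      rfl
    simp only [mpd, Matrix.of_apply, e, Matrix.neg_apply, pd]
    rw [fderiv_fun_neg]
    rfl
  rw [raisedCurvatureDeriv, raisedCurvatureDeriv, h, raisedCurvature_swap k l]
  noncomm_ring

namespace MetricOn

variable (h : MetricOn U A)

include h

/-- This is ∇a⁻¹ = 0, obtained by differentiating A A⁻¹ = 1. -/
theorem mpd_inv (hu : u ∈ U) (m : Fin n) :
    mpd m (fun v => (A v)⁻¹) u =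
      -(connection A m u * (A u)⁻¹) - (A u)⁻¹ * (connection A m u).transpose := by
  have dA : ∀ i j, DifferentiableAt ℝ (fun v => A v i j) u := fun i j =>
    differentiableAt_of_contDiffOn h.isOpen (h.smooth i j) hu
  have dB : ∀ i j, DifferentiableAt ℝ (fun v => (A v)⁻¹ i j) u := fun i j =>
    differentiableAt_of_contDiffOn h.isOpen (h.smooth_inv i j) hu
  have h1 : mpd m (fun v => A v * (A v)⁻¹) u = 0 := by
    rw [mpd_congr (P := fun _ => 1)
      (Filter.mem_of_superset (h.isOpen.mem_nhds hu) fun v hv => h.mul_inv hv)]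
    ext i j
    exact (hasPd_const _).2
  rw [mpd_mul dA dB, h.mpd_metric hu] at h1
  have h2 := congrArg (fun N => (A u)⁻¹ * N) h1
  simp only [Matrix.mul_add, Matrix.add_mul, ← Matrix.mul_assoc, h.inv_mul hu, Matrix.mul_zero,
    Matrix.one_mul] at h2
  rw [Matrix.mul_assoc _ (A u), h.mul_inv hu, Matrix.mul_one] at h2
  rw [eq_comm, ← sub_eq_zero, ← neg_eq_zero, ← h2]
  abel

theorem raisedCurvature_transpose (hu : u ∈ U) (k l : Fin n) :
    (raisedCurvature A k l u).transpose = -raisedCurvature A k l u := by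
  have h2 := congrArg (fun N => (A u)⁻¹ * N * (A u)⁻¹) (h.curvature_antisymm hu k l)
  simp only [Matrix.mul_add, Matrix.add_mul, ← Matrix.mul_assoc, h.inv_mul hu, Matrix.mul_zero,
    Matrix.one_mul, Matrix.zero_mul] at h2
  rw [Matrix.mul_assoc _ (A u), h.mul_inv hu, Matrix.mul_one] at h2
  rw [raisedCurvature, Matrix.transpose_mul, h.inv_transpose hu]
  exact eq_neg_of_add_eq_zero_left h2

theorem raisedCurvature_antisymm (hu : u ∈ U) (k l i j : Fin n) :
    raisedCurvature A k l u i j = -raisedCurvature A k l u j i :=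
  congrFun (congrFun (h.raisedCurvature_transpose hu k l) j) i

theorem smooth_raisedCurvature (k l i j : Fin n) :
    ContDiffOn ℝ ∞ (fun v => raisedCurvature A k l v i j) U :=
  contDiffOn_mul_apply (h.smooth_curvature k l) h.smooth_inv i j

theorem raisedCurvatureDeriv_transpose (hu : u ∈ U) (m k l : Fin n) :
    (raisedCurvatureDeriv A m k l u).transpose = -raisedCurvatureDeriv A m k l u := by
  have h1 : (mpd m (raisedCurvature A k l) u).transpose = -mpd m (raisedCurvature A k l) u := by
    ext i j
    simp only [Matrix.transpose_apply, mpd, Matrix.of_apply, Matrix.neg_apply]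
    rw [pd_congr (g := fun v => -raisedCurvature A k l v i j) (Filter.mem_of_superset
      (h.isOpen.mem_nhds hu) fun v hv => h.raisedCurvature_antisymm hv k l j i)]
    simp only [pd]
    rw [fderiv_fun_neg]
    rfl
  simp only [raisedCurvatureDeriv, Matrix.transpose_add, Matrix.transpose_mul, h1,
    Matrix.transpose_transpose, h.raisedCurvature_transpose hu]
  noncomm_ring

theorem raisedCurvatureDeriv_eq (hu : u ∈ U) (m k l : Fin n) :
    raisedCurvatureDeriv A m k l u =
      (mpd m (curvature A k l) u + connection A m u * curvature A k l u
        - curvature A k l u * connection A m u) * (A u)⁻¹ := by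
  have h1 : mpd m (raisedCurvature A k l) u = mpd m (curvature A k l) u * (A u)⁻¹ +
      curvature A k l u * mpd m (fun v => (A v)⁻¹) u :=
    mpd_mul
      (fun i j => differentiableAt_of_contDiffOn h.isOpen (h.smooth_curvature k l i j) hu)
      (fun i j => differentiableAt_of_contDiffOn h.isOpen (h.smooth_inv i j) hu)
  rw [raisedCurvatureDeriv, h1, h.mpd_inv hu, raisedCurvature]
  noncomm_ring

/-- The identity is already complete without connection terms for the form indices k, l: for a
torsion-free connection those would cancel in the cyclic sum. -/
theorem raisedCurvatureDeriv_cyclic (hu : u ∈ U) (m k l : Fin n) :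
    raisedCurvatureDeriv A m k l u + raisedCurvatureDeriv A k l m u +
      raisedCurvatureDeriv A l m k u = 0 := by
  rw [h.raisedCurvatureDeriv_eq hu, h.raisedCurvatureDeriv_eq hu, h.raisedCurvatureDeriv_eq hu,
    ← Matrix.add_mul, ← Matrix.add_mul, h.second_bianchi hu, Matrix.zero_mul]

variable {lam : E n → ℝ} (hE : ∀ u ∈ U, ∀ i j, ricciTensor A i j u = lam u * A u i j)

include hE

/-- With the metric raised away, the Einstein condition has the constant tensor δ on its right side.
This contraction and its two variants below cover every placement of the trace that occurs in
Schur's lemma. -/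
theorem sum_raisedCurvature (hu : u ∈ U) (l m : Fin n) :
    ∑ k, raisedCurvature A k l u m k = if l = m then -lam u else 0 := by
  have h1 : ∀ k, raisedCurvature A k l u m k = -∑ j, curvature A k l u k j * (A u)⁻¹ j m := by
    intro k
    rw [h.raisedCurvature_antisymm hu, raisedCurvature, Matrix.mul_apply]
  simp only [h1, Finset.sum_neg_distrib]
  rw [Finset.sum_comm]
  simp only [← Finset.sum_mul]
  change -∑ j, ricciTensor A l j u * _ = _
  simp only [hE u hu, mul_assoc, ← Finset.mul_sum]
  rw [← Matrix.mul_apply, h.mul_inv hu, Matrix.one_apply]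
  split_ifs <;> simp

theorem sum_raisedCurvature' (hu : u ∈ U) (l m : Fin n) :
    ∑ k, raisedCurvature A l k u m k = if l = m then lam u else 0 := by
  have h1 : ∀ k, raisedCurvature A l k u m k = -raisedCurvature A k l u m k := by
    intro k
    rw [raisedCurvature_swap k l]
    rfl
  simp only [h1, Finset.sum_neg_distrib, h.sum_raisedCurvature hE hu]
  split_ifs <;> simp

theorem sum_raisedCurvature'' (hu : u ∈ U) (l m : Fin n) :
    ∑ k, raisedCurvature A k l u k m = if l = m then lam u else 0 := by
  simp only [fun k => h.raisedCurvature_antisymm hu k l k m, Finset.sum_neg_distrib,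
    h.sum_raisedCurvature hE hu]
  split_ifs <;> simp

/-- The Einstein scalar is given only as a function; it is smooth because it is the scalar curvature
divided by n. -/
theorem smooth_einsteinScalar (hn : n ≠ 0) : ContDiffOn ℝ ∞ lam U := by
  have h1 : ContDiffOn ℝ ∞ (fun v => (1 / (n : ℝ)) * ∑ l, ∑ k, raisedCurvature A l k v l k) U :=
    contDiffOn_const.mul (ContDiffOn.sum fun l _ => ContDiffOn.sum fun k _ =>
      h.smooth_raisedCurvature l k l k)
  refine h1.congr fun v hv => ?_
  simp only [h.sum_raisedCurvature' hE hv, if_true, Finset.sum_const, Finset.card_univ,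
    Fintype.card_fin, nsmul_eq_mul]
  field_simp

/-- Schur's lemma. -/
theorem pd_einsteinScalar (hn : 3 ≤ n) (hu : u ∈ U) (l : Fin n) : pd l lam u = 0 := by
  have dl : DifferentiableAt ℝ lam u :=
    differentiableAt_of_contDiffOn h.isOpen (h.smooth_einsteinScalar hE (by omega)) hu
  have dP : ∀ k l i j, DifferentiableAt ℝ (fun v => raisedCurvature A k l v i j) u :=
    fun k l i j => differentiableAt_of_contDiffOn h.isOpen (h.smooth_raisedCurvature k l i j) hu
  -- Since the derivative acts on the matrix indices only, each single contraction is not tensorial.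
  -- The defect is always a multiple of λ t, where t = Γ^m_{ml}.
  set t := ∑ m, connection A m u m l with ht
  have ht' : ∑ m, connection A l u m m = t :=
    Finset.sum_congr rfl fun m _ => h.christoffel_symm hu m l m
  have e1 : ∑ m, ∑ k, raisedCurvatureDeriv A m k l u m k = -pd l lam u - lam u * t := by
    have a1 : ∀ m, ∑ k, mpd m (raisedCurvature A k l) u m k = if l = m then -pd l lam u else 0 := by
      intro m
      have : ∑ k, mpd m (raisedCurvature A k l) u m k =
          pd m (fun v => ∑ k, raisedCurvature A k l v m k) u :=
        (HasPd.sum fun k _ => (dP k l m k).hasPd m).2.symm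
      rw [this, pd_congr (g := fun v => if l = m then -lam v else 0) (Filter.mem_of_superset
        (h.isOpen.mem_nhds hu) fun v hv => h.sum_raisedCurvature hE hv l m)]
      split_ifs with hlm
      · rw [← hlm]
        simp only [pd]
        rw [fderiv_fun_neg]
        rfl
      · exact (hasPd_const _).2
    have a2 : ∑ m, ∑ k, (connection A m u * raisedCurvature A k l u) m k = -(lam u * t) := by
      simp only [Matrix.mul_apply]
      have : ∀ m, ∑ k, ∑ p, connection A m u m p * raisedCurvature A k l u p k =
          -(lam u * connection A m u m l) := by
        intro m
        rw [Finset.sum_comm]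
        simp only [← Finset.mul_sum, h.sum_raisedCurvature hE hu]
        simp [mul_comm]
      simp only [this, Finset.sum_neg_distrib, ← Finset.mul_sum, ht]
    -- The curvature is antisymmetric in its upper indices m, p while Γ^k_{mp} is symmetric in them.
    have a3 : ∑ m, ∑ k, (raisedCurvature A k l u * (connection A m u).transpose) m k = 0 := by
      simp only [Matrix.mul_apply, Matrix.transpose_apply]
      rw [Finset.sum_comm]
      refine Finset.sum_eq_zero fun k _ => ?_
      have s : ∑ m, ∑ p, raisedCurvature A k l u m p * connection A m u k p =
          -∑ m, ∑ p, raisedCurvature A k l u m p * connection A m u k p := by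
        conv_lhs => rw [Finset.sum_comm]
        simp only [← Finset.sum_neg_distrib]
        refine Finset.sum_congr rfl fun m _ => Finset.sum_congr rfl fun p _ => ?_
        rw [h.raisedCurvature_antisymm hu k l p m]
        simp only [connection, Matrix.of_apply]
        rw [h.christoffel_symm hu k p m]
        ring
      linarith
    simp only [raisedCurvatureDeriv, Matrix.add_apply, Finset.sum_add_distrib, a1, a2, a3]
    simp
    ring
  have e2 : ∑ m, ∑ k, raisedCurvatureDeriv A k l m u m k = -pd l lam u - lam u * t := by
    rw [← e1, Finset.sum_comm]
    refine Finset.sum_congr rfl fun m _ => Finset.sum_congr rfl fun k _ => ?_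
    rw [raisedCurvatureDeriv_swap m k l]
    exact (congrFun (congrFun (h.raisedCurvatureDeriv_transpose hu m k l) k) m).symm
  have e3 : ∑ m, ∑ k, raisedCurvatureDeriv A l m k u m k = n * pd l lam u + 2 * (lam u * t) := by
    have a1 : ∀ m, ∑ k, mpd l (raisedCurvature A m k) u m k = pd l lam u := by
      intro m
      have : ∑ k, mpd l (raisedCurvature A m k) u m k =
          pd l (fun v => ∑ k, raisedCurvature A m k v m k) u :=
        (HasPd.sum fun k _ => (dP m k m k).hasPd l).2.symm
      rw [this]
      exact pd_congr (Filter.mem_of_superset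
        (h.isOpen.mem_nhds hu) fun v hv => by simpa using h.sum_raisedCurvature' hE hv m m)
    have a2 : ∑ m, ∑ k, (connection A l u * raisedCurvature A m k u) m k = lam u * t := by
      simp only [Matrix.mul_apply]
      have : ∀ m, ∑ k, ∑ p, connection A l u m p * raisedCurvature A m k u p k =
          lam u * connection A l u m m := by
        intro m
        rw [Finset.sum_comm]
        simp only [← Finset.mul_sum, h.sum_raisedCurvature' hE hu]
        simp [mul_comm]
      simp only [this, ← Finset.mul_sum, ht']
    have a3 : ∑ m, ∑ k, (raisedCurvature A m k u * (connection A l u).transpose) m k =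
        lam u * t := by
      simp only [Matrix.mul_apply, Matrix.transpose_apply]
      rw [Finset.sum_comm]
      have : ∀ k, ∑ m, ∑ p, raisedCurvature A m k u m p * connection A l u k p =
          lam u * connection A l u k k := by
        intro k
        rw [Finset.sum_comm]
        simp only [← Finset.sum_mul, h.sum_raisedCurvature'' hE hu]
        simp
      simp only [this, ← Finset.mul_sum, ht']
    simp only [raisedCurvatureDeriv, Matrix.add_apply, Finset.sum_add_distrib, a1, a2, a3]
    simp
    ring
  have e4 : ∑ m, ∑ k, (raisedCurvatureDeriv A m k l u m k + raisedCurvatureDeriv A k l m u m k +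
      raisedCurvatureDeriv A l m k u m k) = 0 :=
    Finset.sum_eq_zero fun m _ => Finset.sum_eq_zero fun k _ =>
      congrFun (congrFun (h.raisedCurvatureDeriv_cyclic hu m k l) m) k
  -- The defects −λt − λt + 2λt cancel and (n − 2) ∂_l λ = 0 remains; this is where n ≥ 3 enters.
  simp only [Finset.sum_add_distrib, e1, e2, e3] at e4
  have hn' : (3 : ℝ) ≤ n := by exact_mod_cast hn
  have : ((n : ℝ) - 2) * pd l lam u = 0 := by linarith
  rcases mul_eq_zero.1 this with h0 | h0
  · linarith
  · exact h0

end MetricOn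

end Schur

/-! ### Constant Killing forms in local coordinates -/

section Killing

variable {n : ℕ}

/-- `A` is a smooth Riemannian metric and `b` a smooth constant Killing form on `U`. -/
structure ConstantKillingOn (U : Set (E n)) (A : E n → Matrix (Fin n) (Fin n) ℝ)
    (b : E n → Fin n → ℝ) : Prop extends MetricOn U A where
  smoothForm : ∀ i, ContDiffOn ℝ ∞ (fun u => b u i) U
  killing : ∀ u ∈ U, ∀ i j, rTensor A b i j u = 0
  sForm_eq_zero : ∀ u ∈ U, ∀ j, sForm A b j u = 0

/-- The matrix `b_{i|j}`. -/
def covDerivMatrix (A : E n → Matrix (Fin n) (Fin n) ℝ) (b : E n → Fin n → ℝ) (u : E n) :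
    Matrix (Fin n) (Fin n) ℝ :=
  Matrix.of fun i j => covDeriv A b i j u

/-- The matrix `bⁱ_{|j}`; for a Killing form this is `sⁱ_j`. -/
def raisedCovDeriv (A : E n → Matrix (Fin n) (Fin n) ℝ) (b : E n → Fin n → ℝ) (u : E n) :
    Matrix (Fin n) (Fin n) ℝ :=
  Matrix.of fun i j => pd j (raise A b i) u + ∑ p, christoffel A i j p u * raise A b p u

variable {U : Set (E n)} {A : E n → Matrix (Fin n) (Fin n) ℝ} {b : E n → Fin n → ℝ} {u : E n}

open scoped MatrixOrder ComplexOrder in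
-- Factoring B = X*X makes the trace that of the positive semidefinite matrix X P X*.
theorem trace_mul_nonneg {B P : Matrix (Fin n) (Fin n) ℝ} (hB : B.PosSemidef)
    (hP : P.PosSemidef) : 0 ≤ (B * P).trace := by
  obtain ⟨X, rfl⟩ := CStarAlgebra.nonneg_iff_eq_star_mul_self.mp hB.nonneg
  have h := (hP.mul_mul_conjTranspose_same X).trace_nonneg
  rwa [Matrix.trace_mul_comm, ← Matrix.mul_assoc] at h

theorem MetricOn.lower_raise (h : MetricOn U A) (hu : u ∈ U) (k : Fin n) :
    ∑ p, A u k p * raise A b p u = b u k := by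
  have h1 : (A u).mulVec ((A u)⁻¹.mulVec (b u)) k = b u k := by
    rw [Matrix.mulVec_mulVec, h.mul_inv hu, Matrix.one_mulVec]
  exact h1

theorem MetricOn.smooth_raise (h : MetricOn U A) (hb : ∀ i, ContDiffOn ℝ ∞ (fun u => b u i) U)
    (i : Fin n) : ContDiffOn ℝ ∞ (raise A b i) U :=
  ContDiffOn.sum fun j _ => (h.smooth_inv i j).mul (hb j)

/-- Lowering an index commutes with covariant differentiation because the metric is parallel. -/
theorem MetricOn.metric_mul_raisedCovDeriv (h : MetricOn U A)
    (hb : ∀ i, ContDiffOn ℝ ∞ (fun u => b u i) U) (hu : u ∈ U) :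
    A u * raisedCovDeriv A b u = covDerivMatrix A b u := by
  ext k j
  have h1 : pd j (fun v => b v k) u = ∑ p, (pd j (fun v => A v k p) u * raise A b p u +
      A u k p * pd j (raise A b p) u) := by
    rw [pd_congr (g := fun v => ∑ p, A v k p * raise A b p v) (Filter.mem_of_superset
        (h.isOpen.mem_nhds hu) fun v hv => (h.lower_raise hv k).symm)]
    exact (HasPd.sum fun p _ => (hasPd_of_contDiffOn h.isOpen (h.smooth k p) hu j).mul
      (hasPd_of_contDiffOn h.isOpen (h.smooth_raise hb p) hu j)).2
  have h2 : ∑ m, christoffel A m k j u * b u m =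
      ∑ p, ∑ m, christoffel A m j k u * A u m p * raise A b p u := by
    rw [Finset.sum_comm]
    refine Finset.sum_congr rfl fun m _ => ?_
    simp only [mul_assoc, ← Finset.mul_sum, h.lower_raise hu m, h.christoffel_symm hu m k j]
  have h3 : ∑ m, A u k m * ∑ p, christoffel A m j p u * raise A b p u =
      ∑ p, ∑ m, A u k m * christoffel A m j p u * raise A b p u := by
    rw [Finset.sum_comm]
    simp only [Finset.mul_sum, mul_assoc]
  simp only [Matrix.mul_apply, raisedCovDeriv, covDerivMatrix, Matrix.of_apply, covDeriv, h1, h2,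
    mul_add, Finset.sum_add_distrib, h3, h.pd_metric hu, add_mul, Finset.sum_mul]
  ring

namespace ConstantKillingOn

variable (h : ConstantKillingOn U A b)

include h

theorem metric_mul_raisedCovDeriv (hu : u ∈ U) :
    A u * raisedCovDeriv A b u = covDerivMatrix A b u :=
  h.toMetricOn.metric_mul_raisedCovDeriv h.smoothForm hu

theorem smooth_raise (i : Fin n) : ContDiffOn ℝ ∞ (raise A b i) U :=
  h.toMetricOn.smooth_raise h.smoothForm i

theorem smooth_raisedCovDeriv (i j : Fin n) :
    ContDiffOn ℝ ∞ (fun v => raisedCovDeriv A b v i j) U :=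
  (contDiffOn_pd h.isOpen (h.smooth_raise i) j).add (ContDiffOn.sum fun p _ =>
    (h.smooth_christoffel i j p).mul (h.smooth_raise p))

theorem covDeriv_antisymm (hu : u ∈ U) (i j : Fin n) :
    covDeriv A b i j u = -covDeriv A b j i u := by
  have := h.killing u hu i j
  simp only [rTensor] at this
  linarith

theorem covDerivMatrix_transpose (hu : u ∈ U) :
    (covDerivMatrix A b u).transpose = -covDerivMatrix A b u := by
  ext i j
  exact h.covDeriv_antisymm hu j i

theorem raisedCovDeriv_eq (hu : u ∈ U) :
    raisedCovDeriv A b u = (A u)⁻¹ * covDerivMatrix A b u := by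
  rw [← h.metric_mul_raisedCovDeriv hu, ← Matrix.mul_assoc, h.inv_mul hu, Matrix.one_mul]

/-- A Killing field is divergence free: this is the trace of a symmetric matrix times an
antisymmetric one. -/
theorem trace_raisedCovDeriv (hu : u ∈ U) : ∑ k, raisedCovDeriv A b u k k = 0 := by
  have h1 : (raisedCovDeriv A b u).trace = -(raisedCovDeriv A b u).trace := by
    conv_lhs => rw [h.raisedCovDeriv_eq hu, ← Matrix.trace_transpose, Matrix.transpose_mul,
      h.covDerivMatrix_transpose hu, h.inv_transpose hu, Matrix.neg_mul, Matrix.trace_neg,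
      Matrix.trace_mul_comm, ← h.raisedCovDeriv_eq hu]
  have : (raisedCovDeriv A b u).trace = 0 := by linarith
  exact this

theorem raise_mul_covDeriv (hu : u ∈ U) (j : Fin n) :
    ∑ i, raise A b i u * covDeriv A b i j u = 0 := by
  rw [← h.sForm_eq_zero u hu j]
  refine Finset.sum_congr rfl fun i _ => ?_
  rw [sTensor, h.covDeriv_antisymm hu j i]
  ring

theorem covDeriv_mul_raise (hu : u ∈ U) (i : Fin n) :
    ∑ j, covDeriv A b i j u * raise A b j u = 0 := by
  rw [← neg_eq_zero, ← h.raise_mul_covDeriv hu i, ← Finset.sum_neg_distrib]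
  refine Finset.sum_congr rfl fun j _ => ?_
  rw [h.covDeriv_antisymm hu i j]
  ring

theorem form_mul_raisedCovDeriv (hu : u ∈ U) (j : Fin n) :
    ∑ k, b u k * raisedCovDeriv A b u k j = 0 := by
  rw [← h.raise_mul_covDeriv hu j]
  have e : ∀ k, covDeriv A b k j u = ∑ i, A u k i * raisedCovDeriv A b u i j := fun k =>
    (congrFun (congrFun (h.metric_mul_raisedCovDeriv hu) k) j).symm
  simp only [e, Finset.mul_sum]
  rw [Finset.sum_comm]
  refine Finset.sum_congr rfl fun k _ => ?_
  rw [← h.lower_raise (b := b) hu k, Finset.sum_mul]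
  refine Finset.sum_congr rfl fun i _ => ?_
  rw [h.symm_apply hu k i]
  ring

theorem raisedCovDeriv_mul_raise (hu : u ∈ U) (i : Fin n) :
    ∑ j, raisedCovDeriv A b u i j * raise A b j u = 0 := by
  rw [h.raisedCovDeriv_eq hu]
  simp only [Matrix.mul_apply, Finset.sum_mul]
  rw [Finset.sum_comm]
  simp only [mul_assoc, ← Finset.mul_sum]
  refine Finset.sum_eq_zero fun k _ => ?_
  rw [show ∑ j, covDerivMatrix A b u k j * raise A b j u = 0 from h.covDeriv_mul_raise hu k,
    mul_zero]

theorem hasPd_raise (hu : u ∈ U) (i k : Fin n) :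
    HasPd k (raise A b i)
      (raisedCovDeriv A b u i k - ∑ p, christoffel A i k p u * raise A b p u) u :=
  (hasPd_of_contDiffOn h.isOpen (h.smooth_raise i) hu k).congr_deriv
    (by simp [raisedCovDeriv])

theorem hasPd_form (hu : u ∈ U) (i k : Fin n) :
    HasPd k (fun v => b v i) (covDeriv A b i k u + ∑ p, christoffel A p i k u * b u p) u :=
  (hasPd_of_contDiffOn h.isOpen (h.smoothForm i) hu k).congr_deriv (by simp [covDeriv])

theorem smooth_coordNormSq : ContDiffOn ℝ ∞ (coordNormSq A b) U :=
  ContDiffOn.sum fun i _ => (h.smooth_raise i).mul (h.smoothForm i)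

/-- A constant Killing form has constant length. -/
theorem pd_coordNormSq (hu : u ∈ U) (k : Fin n) : pd k (coordNormSq A b) u = 0 := by
  have h1 : HasPd k (coordNormSq A b) _ u :=
    HasPd.sum fun i _ => (h.hasPd_raise hu i k).mul (h.hasPd_form hu i k)
  rw [h1.2]
  have e1 : ∑ i, (∑ p, christoffel A i k p u * raise A b p u) * b u i =
      ∑ i, raise A b i u * ∑ p, christoffel A p i k u * b u p := by
    simp only [Finset.sum_mul, Finset.mul_sum]
    rw [Finset.sum_comm]
    refine Finset.sum_congr rfl fun i _ => Finset.sum_congr rfl fun p _ => ?_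
    rw [h.christoffel_symm hu p i k]
    ring
  have e2 : ∑ i, raisedCovDeriv A b u i k * b u i = 0 := by
    rw [← h.form_mul_raisedCovDeriv hu k]
    exact Finset.sum_congr rfl fun i _ => mul_comm _ _
  simp only [sub_mul, mul_add, Finset.sum_add_distrib, Finset.sum_sub_distrib, e1, e2,
    h.raise_mul_covDeriv hu k]
  ring

/-- The divergence `sᵏ_{j|k}`. -/
theorem div_raisedCovDeriv (hu : u ∈ U) (j : Fin n) :
    ∑ k, (pd k (fun v => raisedCovDeriv A b v k j) u +
      ∑ m, (christoffel A k k m u * raisedCovDeriv A b u m j -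
        christoffel A m k j u * raisedCovDeriv A b u k m)) =
      ∑ p, ricciTensor A j p u * raise A b p u := by
  have dG := fun k i j l => hasPd_of_contDiffOn h.isOpen (h.smooth_christoffel i k j) hu l
  have dV := fun i l => hasPd_of_contDiffOn h.isOpen (h.smooth_raise i) hu l
  have dS : ∀ i j l, pd l (fun v => raisedCovDeriv A b v i j) u = pd l (pd j (raise A b i)) u +
      ∑ p, (pd l (christoffel A i j p) u * raise A b p u +
        christoffel A i j p u * pd l (raise A b p) u) := fun i j l =>
    ((hasPd_of_contDiffOn h.isOpen (contDiffOn_pd h.isOpen (h.smooth_raise i) j) hu l).add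
      (HasPd.sum fun p _ => (dG j i p l).mul (dV p l))).2
  -- The identity sought is the contracted Ricci identity b^k_{|j|k} − b^k_{|k|j} = Ric_{jp} b^p.
  -- The second term is the derivative of the divergence, which vanishes; subtracting it as zero
  -- makes the second derivatives of b^k cancel.
  have hT : ∑ k, pd j (fun v => raisedCovDeriv A b v k k) u = 0 := by
    rw [← (HasPd.sum fun k _ => hasPd_of_contDiffOn h.isOpen
      (h.smooth_raisedCovDeriv k k) hu j).2, pd_congr (g := fun _ => 0) (Filter.mem_of_superset
        (h.isOpen.mem_nhds hu) fun v hv => h.trace_raisedCovDeriv hv)]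
    exact (hasPd_const _).2
  rw [← sub_zero (∑ k, (_ + _)), ← hT]
  simp only [dS, fun k => pd_comm h.isOpen (h.smooth_raise k) hu j k]
  have e0 : ∑ p, ricciTensor A j p u * raise A b p u = ∑ k, ∑ p,
      ((pd k (christoffel A k j p) u - pd j (christoffel A k k p) u) * raise A b p u +
        ∑ m, (christoffel A k k m u * christoffel A m j p u * raise A b p u -
          christoffel A k j m u * christoffel A m k p u * raise A b p u)) := by
    simp only [ricciTensor, Finset.sum_mul]
    rw [Finset.sum_comm]
    refine Finset.sum_congr rfl fun k _ => Finset.sum_congr rfl fun p _ => ?_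
    simp only [curvature, Matrix.add_apply, Matrix.sub_apply, Matrix.mul_apply, mpd,
      Matrix.of_apply, connection, add_mul, sub_mul, Finset.sum_mul, Finset.sum_sub_distrib]
  rw [e0, ← sub_eq_zero]
  have e1 : ∀ k m, christoffel A k k m u * raisedCovDeriv A b u m j =
      christoffel A k k m u * pd j (raise A b m) u +
        ∑ p, christoffel A k k m u * christoffel A m j p u * raise A b p u := by
    intro k m
    simp only [raisedCovDeriv, Matrix.of_apply, mul_add, Finset.mul_sum, mul_assoc]
  have e2 : ∀ k m, christoffel A m k j u * raisedCovDeriv A b u k m =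
      christoffel A k j m u * 0 + christoffel A m k j u * pd m (raise A b k) u +
        ∑ p, christoffel A m k j u * christoffel A k m p u * raise A b p u := by
    intro k m
    simp only [raisedCovDeriv, Matrix.of_apply, mul_add, Finset.mul_sum, mul_assoc, mul_zero,
      zero_add]
  have e3 : ∑ k, ∑ m, christoffel A m k j u * pd m (raise A b k) u =
      ∑ k, ∑ p, christoffel A k j p u * pd k (raise A b p) u := by
    rw [Finset.sum_comm]
    refine Finset.sum_congr rfl fun k _ => Finset.sum_congr rfl fun p _ => ?_
    rw [h.christoffel_symm hu k p j]
  have e4 : ∑ k, ∑ m, ∑ p, christoffel A m k j u * christoffel A k m p u * raise A b p u =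
      ∑ k, ∑ p, ∑ m, christoffel A k j m u * christoffel A m k p u * raise A b p u := by
    rw [Finset.sum_comm]
    refine Finset.sum_congr rfl fun k _ => ?_
    rw [Finset.sum_comm]
    refine Finset.sum_congr rfl fun p _ => Finset.sum_congr rfl fun m _ => ?_
    rw [h.christoffel_symm hu k m j]
  have e5 : ∑ k, ∑ m, ∑ p, christoffel A k k m u * christoffel A m j p u * raise A b p u =
      ∑ k, ∑ p, ∑ m, christoffel A k k m u * christoffel A m j p u * raise A b p u :=
    Finset.sum_congr rfl fun k _ => Finset.sum_comm
  simp only [e1, e2, mul_zero, zero_add, Finset.sum_add_distrib, Finset.sum_sub_distrib, sub_mul,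
    e3, e4, e5]
  ring

/-- `‖s‖² = Ric(b, b)`. -/
theorem ricci_raise_raise (hu : u ∈ U) :
    ∑ j, ∑ p, ricciTensor A j p u * raise A b j u * raise A b p u =
      -∑ k, ∑ m, raisedCovDeriv A b u k m * raisedCovDeriv A b u m k := by
  have dS := fun i j l => hasPd_of_contDiffOn h.isOpen (h.smooth_raisedCovDeriv i j) hu l
  -- Take the divergence of the vanishing vector s^k_j b^j: in covariant form it says s^k_{j|k} b^j
  -- + s^k_j s^j_k = 0, and the first term is Ric(b♯, b♯).
  have h1 : ∑ k, ∑ j, (pd k (fun v => raisedCovDeriv A b v k j) u * raise A b j u +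
      raisedCovDeriv A b u k j * (raisedCovDeriv A b u j k -
        ∑ p, christoffel A j k p u * raise A b p u)) = 0 := by
    refine Finset.sum_eq_zero fun k _ => ?_
    rw [← (HasPd.sum fun j _ => (dS k j k).mul (h.hasPd_raise hu j k)).2,
      pd_congr (g := fun _ => 0) (Filter.mem_of_superset
        (h.isOpen.mem_nhds hu) fun v hv => h.raisedCovDeriv_mul_raise hv k)]
    exact (hasPd_const _).2
  have h2 : ∑ j, raise A b j u * ∑ p, ricciTensor A j p u * raise A b p u =
      ∑ j, ∑ p, ricciTensor A j p u * raise A b j u * raise A b p u := by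
    simp only [Finset.mul_sum]
    exact Finset.sum_congr rfl fun j _ => Finset.sum_congr rfl fun p _ => by ring
  rw [← h2]
  simp only [← h.div_raisedCovDeriv hu, Finset.sum_add_distrib, Finset.sum_sub_distrib, mul_add,
    mul_sub]
  simp only [Finset.sum_add_distrib, mul_sub, Finset.sum_sub_distrib] at h1
  have e1 : ∑ j, raise A b j u * ∑ k, pd k (fun v => raisedCovDeriv A b v k j) u =
      ∑ k, ∑ j, pd k (fun v => raisedCovDeriv A b v k j) u * raise A b j u := by
    simp only [Finset.mul_sum]
    rw [Finset.sum_comm]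
    exact Finset.sum_congr rfl fun k _ => Finset.sum_congr rfl fun j _ => mul_comm _ _
  have e2 : ∑ j, raise A b j u * ∑ k, ∑ m,
      christoffel A k k m u * raisedCovDeriv A b u m j = 0 := by
    simp only [Finset.mul_sum]
    rw [Finset.sum_comm]
    refine Finset.sum_eq_zero fun k _ => ?_
    rw [Finset.sum_comm]
    refine Finset.sum_eq_zero fun m _ => ?_
    have : ∑ j, raise A b j u * (christoffel A k k m u * raisedCovDeriv A b u m j) =
        christoffel A k k m u * ∑ j, raisedCovDeriv A b u m j * raise A b j u := by
      rw [Finset.mul_sum]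
      exact Finset.sum_congr rfl fun j _ => by ring
    rw [this, h.raisedCovDeriv_mul_raise hu, mul_zero]
  have e3 : ∑ j, raise A b j u * ∑ k, ∑ m,
      christoffel A m k j u * raisedCovDeriv A b u k m =
      ∑ k, ∑ j, raisedCovDeriv A b u k j * ∑ p, christoffel A j k p u * raise A b p u := by
    simp only [Finset.mul_sum]
    rw [Finset.sum_comm]
    refine Finset.sum_congr rfl fun k _ => ?_
    rw [Finset.sum_comm]
    exact Finset.sum_congr rfl fun m _ => Finset.sum_congr rfl fun j _ => by ring
  rw [e1, e2, e3]
  linarith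

theorem ricci_raise_raise_nonneg (hu : u ∈ U) :
    0 ≤ ∑ j, ∑ p, ricciTensor A j p u * raise A b j u * raise A b p u := by
  rw [h.ricci_raise_raise hu]
  -- With S = A⁻¹C and Cᵀ = −C, the number −tr(S²) becomes tr(A⁻¹ · C A⁻¹ Cᵀ), the trace of a
  -- product of two positive semidefinite matrices.
  have e : -∑ k, ∑ m, raisedCovDeriv A b u k m * raisedCovDeriv A b u m k =
      ((A u)⁻¹ * (covDerivMatrix A b u * (A u)⁻¹ * (covDerivMatrix A b u).transpose)).trace := by
    rw [h.covDerivMatrix_transpose hu, Matrix.mul_neg, Matrix.mul_neg, Matrix.trace_neg,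
      Matrix.mul_assoc, ← Matrix.mul_assoc, ← h.raisedCovDeriv_eq hu]
    simp only [Matrix.trace, Matrix.diag, Matrix.mul_apply]
  rw [e]
  have p1 : ((A u)⁻¹).PosSemidef := (h.posDef u hu).inv.posSemidef
  have p2 := p1.mul_mul_conjTranspose_same (covDerivMatrix A b u)
  rw [Matrix.conjTranspose_eq_transpose_of_trivial] at p2
  exact trace_mul_nonneg p1 p2

end ConstantKillingOn

end Killing

/-! ### Sprays and their Ricci curvature -/

section Sprays

open scoped Matrix

variable {n : ℕ}

/-- The quadratic form of a matrix. -/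
def quad (N : Matrix (Fin n) (Fin n) ℝ) (y : E n) : ℝ := y.ofLp ⬝ᵥ (N *ᵥ y.ofLp)

/-- The matrix `(Γᵖ_{ij})_{ij}`. -/
def christoffelMatrix (A : E n → Matrix (Fin n) (Fin n) ℝ) (p : Fin n) (u : E n) :
    Matrix (Fin n) (Fin n) ℝ :=
  Matrix.of fun i j => christoffel A p i j u

theorem quad_eq_sum (N : Matrix (Fin n) (Fin n) ℝ) (y : E n) :
    quad N y = ∑ i, ∑ j, N i j * y i * y j := by
  simp only [quad, Matrix.mulVec, dotProduct, Finset.mul_sum]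
  exact Finset.sum_congr rfl fun i _ => Finset.sum_congr rfl fun j _ => by ring

theorem quad_eq_sum_dotProduct (N : Matrix (Fin n) (Fin n) ℝ) (y : E n) :
    quad N y = ∑ j, y j * (N j ⬝ᵥ y.ofLp) := rfl

theorem sum_comm_pairs {ι : Type*} [Fintype ι] (f : ι → ι → ι → ι → ℝ) :
    ∑ a, ∑ b, ∑ c, ∑ d, f a b c d = ∑ c, ∑ d, ∑ a, ∑ b, f a b c d := by
  have h := Finset.sum_comm (s := Finset.univ) (t := Finset.univ)
    (f := fun (p q : ι × ι) => f p.1 p.2 q.1 q.2)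
  simpa only [Fintype.sum_prod_type] using h

theorem hasPd_dotProduct {i : Fin n} {u : E n} (c : Fin n → ℝ) :
    HasPd i (fun y => c ⬝ᵥ y.ofLp) (c i) u :=
  hasPd_linear c

theorem hasPd_quad {N : Matrix (Fin n) (Fin n) ℝ} (hN : N.transpose = N) {i : Fin n} {y : E n} :
    HasPd i (quad N) (2 * (N *ᵥ y.ofLp) i) y := by
  have h : HasPd i (fun y => ∑ j, y j * (N j ⬝ᵥ y.ofLp)) _ y :=
    HasPd.sum fun j _ => (hasPd_coord j).mul (hasPd_dotProduct (u := y) (N j))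
  simp only [← quad_eq_sum_dotProduct] at h
  refine h.congr_deriv ?_
  have e : ∀ j, N j i = N i j := fun j => congrFun (congrFun hN i) j
  simp only [e, Finset.sum_add_distrib, ite_mul, one_mul, zero_mul, Finset.sum_ite_eq',
    Finset.mem_univ, if_true, Matrix.mulVec, dotProduct]
  rw [two_mul]
  congr 1
  exact Finset.sum_congr rfl fun j _ => mul_comm _ _

theorem hasPd_dotProduct_left {i : Fin n} {u : E n} {c : E n → Fin n → ℝ} {d : Fin n → ℝ}
    (hc : ∀ j, HasPd i (fun v => c v j) (d j) u) (y : E n) :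
    HasPd i (fun v => c v ⬝ᵥ y.ofLp) (d ⬝ᵥ y.ofLp) u :=
  (HasPd.sum fun j _ => (hc j).mul (hasPd_const (y j))).congr_deriv (by simp [dotProduct])

theorem hasPd_quad_left {i : Fin n} {u : E n} {N : E n → Matrix (Fin n) (Fin n) ℝ}
    (hN : ∀ j k, DifferentiableAt ℝ (fun v => N v j k) u) (y : E n) :
    HasPd i (fun v => quad (N v) y) (quad (mpd i N u) y) u := by
  simp only [quad_eq_sum_dotProduct]
  exact HasPd.sum fun j _ => (hasPd_dotProduct_left (c := fun v => N v j)
    (fun k => (hN j k).hasPd i) y).const_mul (y j)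

/-- If `G = H` on an open set, and `D` is the divergence of `H` in `y`, then `Ric` can be computed
from `H` and `D`. -/
theorem ricci_eq_of_spray {F : E n → E n → ℝ} {H : Fin n → E n → E n → ℝ}
    {Hy : Fin n → Fin n → E n → E n → ℝ} {D : E n → E n → ℝ} {Hx Dx Dy : Fin n → ℝ}
    {Ω : Set (E n × E n)} (hΩ : IsOpen Ω) {u y : E n} (huy : (u, y) ∈ Ω)
    (hG : ∀ v z, (v, z) ∈ Ω → ∀ i, geodesicCoeff F i v z = H i v z)
    (hHy : ∀ v z, (v, z) ∈ Ω → ∀ i k, HasPd k (H i v) (Hy i k v z) z)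
    (hHx : ∀ m, HasPd m (fun v => H m v y) (Hx m) u)
    (hdx : ∀ m, DifferentiableAt ℝ (fun v => Hy m m v y) u)
    (hdy : ∀ m, DifferentiableAt ℝ (Hy m m u) y)
    (hD : ∀ v z, (v, z) ∈ Ω → ∑ m, Hy m m v z = D v z)
    (hDx : ∀ k, HasPd k (fun v => D v y) (Dx k) u) (hDy : ∀ k, HasPd k (D u) (Dy k) y) :
    ricci F u y = 2 * ∑ m, Hx m - ∑ k, Dx k * y k + 2 * ∑ k, H k u y * Dy k -
      ∑ m, ∑ k, Hy m k u y * Hy k m u y := by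
  have hx : ∀ᶠ v in nhds u, (v, y) ∈ Ω :=
    (Continuous.prodMk_left y).continuousAt.preimage_mem_nhds (hΩ.mem_nhds huy)
  have hy : ∀ v z, (v, z) ∈ Ω → ∀ᶠ z' in nhds z, (v, z') ∈ Ω := fun v z hvz =>
    (Continuous.prodMk_right v).continuousAt.preimage_mem_nhds (hΩ.mem_nhds hvz)
  have hGy : ∀ v z, (v, z) ∈ Ω → ∀ i k, pd k (geodesicCoeff F i v) z = Hy i k v z :=
    fun v z hvz i k => (pd_congr ((hy v z hvz).mono fun z' hz' => hG v z' hz' i)).trans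
      (hHy v z hvz i k).2
  have e1 : ∀ m, pd m (fun v => geodesicCoeff F m v y) u = Hx m := fun m =>
    (pd_congr (hx.mono fun v hv => hG v y hv m)).trans (hHx m).2
  have e2 : ∀ m k, pd m (fun v => pd k (geodesicCoeff F k v) y) u =
      pd m (fun v => Hy k k v y) u := fun m k =>
    pd_congr (hx.mono fun v hv => hGy v y hv k k)
  have e3 : ∀ m k, pd m (fun z => pd k (geodesicCoeff F k u) z) y = pd m (Hy k k u) y := fun m k =>
    pd_congr ((hy u y huy).mono fun z hz => hGy u z hz k k)
  -- In the trace, both second-derivative terms involve only ∂G^m/∂y^m. Differentiating its closed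
  -- form D avoids computing second derivatives of H; the individual summands need only be
  -- differentiable.
  have e4 : ∀ k, ∑ m, pd k (fun v => Hy m m v y) u = Dx k := by
    intro k
    rw [← (hDx k).2, ← (HasPd.sum fun m _ => (hdx m).hasPd k).2]
    exact pd_congr (hx.mono fun v hv => hD v y hv)
  have e5 : ∀ k, ∑ m, pd k (Hy m m u) y = Dy k := by
    intro k
    rw [← (hDy k).2, ← (HasPd.sum fun m _ => (hdy m).hasPd k).2]
    exact pd_congr ((hy u y huy).mono fun z hz => hD u z hz)
  simp only [ricci, riemannCurv, e1, e2, e3, hG u y huy, hGy u y huy, Finset.sum_add_distrib,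
    Finset.sum_sub_distrib, ← Finset.mul_sum]
  rw [Finset.sum_comm (f := fun m k => pd k (fun v => Hy m m v y) u * y k),
    Finset.sum_comm (f := fun m k => H k u y * pd k (Hy m m u) y)]
  simp only [← Finset.mul_sum, ← Finset.sum_mul, e4, e5]

/-- This replaces the inversion of g by the verification of a candidate solution X = 4G of a linear
system. -/
theorem geodesicCoeff_eq_of_mulVec {F : E n → E n → ℝ} {u y : E n}
    (hdet : (fundamentalTensor F u y).det ≠ 0) {X : Fin n → ℝ}
    (hX : ∀ l, (fundamentalTensor F u y *ᵥ X) l =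
      (∑ k, pd k (fun v => pd l (sqF F v) y) u * y k) - pd l (fun v => sqF F v y) u) (i : Fin n) :
    geodesicCoeff F i u y = (1 / 4) * X i := by
  simp only [geodesicCoeff, ← hX]
  change _ * ((fundamentalTensor F u y)⁻¹ *ᵥ (fundamentalTensor F u y *ᵥ X)) i = _
  rw [Matrix.mulVec_mulVec, Matrix.nonsing_inv_mul _ hdet.isUnit, Matrix.one_mulVec]

variable {U : Set (E n)} {A : E n → Matrix (Fin n) (Fin n) ℝ} {u : E n}

namespace MetricOn

variable (h : MetricOn U A)

include h

theorem christoffelMatrix_transpose (hu : u ∈ U) (p : Fin n) :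
    (christoffelMatrix A p u).transpose = christoffelMatrix A p u := by
  ext i j
  exact h.christoffel_symm hu p j i

theorem differentiableAt_metric (hu : u ∈ U) (i j : Fin n) :
    DifferentiableAt ℝ (fun v => A v i j) u :=
  differentiableAt_of_contDiffOn h.isOpen (h.smooth i j) hu

theorem differentiableAt_christoffel (hu : u ∈ U) (k i j : Fin n) :
    DifferentiableAt ℝ (christoffel A k i j) u :=
  differentiableAt_of_contDiffOn h.isOpen (h.smooth_christoffel k i j) hu

/-- `y^k ∂_k a_{lj} y^j = a_{lp} Γᵖ_{00} + ½ ∂_l a_{jk} y^j y^k`. -/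
theorem sum_mpd_metric (hu : u ∈ U) (y : E n) (l : Fin n) :
    ∑ k, (mpd k A u *ᵥ y.ofLp) l * y k =
      (A u *ᵥ fun p => quad (christoffelMatrix A p u) y) l + (1 / 2) * quad (mpd l A u) y := by
  have e1 : (A u *ᵥ fun p => quad (christoffelMatrix A p u) y) l =
      ∑ i, ∑ j, ((1 / 2) * (pd i (fun v => A v l j) u + pd j (fun v => A v l i) u -
        pd l (fun v => A v i j) u)) * y i * y j := by
    simp only [← h.lower_christoffel hu, Matrix.mulVec, dotProduct, quad_eq_sum, Finset.mul_sum,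
      Finset.sum_mul, christoffelMatrix, Matrix.of_apply]
    rw [Finset.sum_comm]
    refine Finset.sum_congr rfl fun i _ => ?_
    rw [Finset.sum_comm]
    exact Finset.sum_congr rfl fun j _ => Finset.sum_congr rfl fun p _ => by ring
  have e2 : ∑ i, ∑ j, pd i (fun v => A v l j) u * y i * y j =
      ∑ k, (mpd k A u *ᵥ y.ofLp) l * y k := by
    simp only [Matrix.mulVec, dotProduct, Finset.sum_mul, mpd, Matrix.of_apply]
    exact Finset.sum_congr rfl fun j _ => Finset.sum_congr rfl fun p _ => by ring
  have e3 : ∑ i, ∑ j, pd j (fun v => A v l i) u * y i * y j =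
      ∑ k, (mpd k A u *ᵥ y.ofLp) l * y k := by
    rw [← e2, Finset.sum_comm]
    exact Finset.sum_congr rfl fun j _ => Finset.sum_congr rfl fun p _ => by ring
  rw [e1, quad_eq_sum]
  simp only [mul_assoc, ← Finset.mul_sum]
  simp only [add_mul, sub_mul, Finset.sum_add_distrib, Finset.sum_sub_distrib, ← mul_assoc, e2, e3]
  simp only [mpd, Matrix.of_apply]
  ring

theorem sum_quad_mpd_metric (hu : u ∈ U) (y : E n) :
    ∑ k, quad (mpd k A u) y * y k =
      2 * ((A u *ᵥ y.ofLp) ⬝ᵥ fun p => quad (christoffelMatrix A p u) y) := by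
  have h1 : ∑ l, y l * ∑ k, (mpd k A u *ᵥ y.ofLp) l * y k = ∑ k, quad (mpd k A u) y * y k := by
    simp only [Finset.mul_sum]
    rw [Finset.sum_comm]
    refine Finset.sum_congr rfl fun k _ => ?_
    simp only [quad, dotProduct, Finset.sum_mul, mul_assoc]
  have h2 : ∑ l, y l * (A u *ᵥ fun p => quad (christoffelMatrix A p u) y) l =
      (A u *ᵥ y.ofLp) ⬝ᵥ fun p => quad (christoffelMatrix A p u) y := by
    change y.ofLp ⬝ᵥ _ = _
    rw [Matrix.dotProduct_mulVec, ← Matrix.mulVec_transpose, h.transpose_eq hu]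
  simp only [h.sum_mpd_metric hu, mul_add, Finset.sum_add_distrib, h2] at h1
  have h3 : ∑ l, y l * ((1 / 2) * quad (mpd l A u) y) =
      (1 / 2) * ∑ k, quad (mpd k A u) y * y k := by
    rw [Finset.mul_sum]
    exact Finset.sum_congr rfl fun j _ => by ring
  rw [h3] at h1
  linarith

/-- This says that α² is horizontally constant: by metric compatibility ∂_k α² equals Γ^m_{k0} times
∂α²/∂y^m. -/
theorem quad_mpd_metric (hu : u ∈ U) (y : E n) (k : Fin n) :
    quad (mpd k A u) y = 2 * ∑ p, (christoffelMatrix A p u *ᵥ y.ofLp) k * (A u *ᵥ y.ofLp) p := by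
  have e1 : quad ((connection A k u).transpose * A u) y = quad (A u * connection A k u) y := by
    simp only [quad]
    rw [Matrix.dotProduct_mulVec, dotProduct_comm, ← Matrix.mulVec_transpose,
      Matrix.transpose_mul, Matrix.transpose_transpose, h.transpose_eq hu]
  have e2 : ∑ p, (christoffelMatrix A p u *ᵥ y.ofLp) k * (A u *ᵥ y.ofLp) p =
      quad ((connection A k u).transpose * A u) y := by
    simp only [quad]
    rw [← Matrix.mulVec_mulVec, Matrix.dotProduct_mulVec, Matrix.vecMul_transpose]
    rfl
  rw [h.mpd_metric hu, e2, quad, Matrix.add_mulVec, dotProduct_add]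
  change quad _ y + quad _ y = _
  rw [← e1]
  ring

/-- The geodesic coefficients of a Riemannian metric. -/
theorem geodesicCoeff_riemannian {F : E n → E n → ℝ}
    (hF : ∀ v ∈ U, ∀ z, sqF F v z = quad (A v) z) (hu : u ∈ U) (y : E n) (i : Fin n) :
    geodesicCoeff F i u y = (1 / 2) * quad (christoffelMatrix A i u) y := by
  have hy : ∀ v ∈ U, ∀ z l, pd l (sqF F v) z = 2 * (A v *ᵥ z.ofLp) l := fun v hv z l => by
    rw [show sqF F v = quad (A v) from funext (hF v hv)]
    exact (hasPd_quad (h.transpose_eq hv)).2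
  have hg : fundamentalTensor F u y = A u := by
    ext k l
    simp only [fundamentalTensor, Matrix.of_apply, hy u hu]
    have e : pd k (fun z => 2 * (A u *ᵥ z.ofLp) l) y = 2 * A u l k :=
      ((hasPd_dotProduct (A u l)).const_mul 2).2
    rw [e, h.symm_apply hu k l]
    ring
  rw [geodesicCoeff_eq_of_mulVec (X := fun p => 2 * quad (christoffelMatrix A p u) y)
    (hg ▸ h.det_ne_zero hu)]
  · ring
  · intro l
    have nU := h.isOpen.mem_nhds hu
    have e1 : ∀ k, pd k (fun v => pd l (sqF F v) y) u = 2 * (mpd k A u *ᵥ y.ofLp) l := fun k => by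
      rw [pd_congr (Filter.mem_of_superset nU fun v hv => hy v hv y l)]
      exact ((hasPd_dotProduct_left (c := fun v => A v l)
        (fun j => (h.differentiableAt_metric hu l j).hasPd k) y).const_mul 2).2
    have e2 : pd l (fun v => sqF F v y) u = quad (mpd l A u) y := by
      rw [pd_congr (Filter.mem_of_superset nU fun v hv => hF v hv y)]
      exact (hasPd_quad_left (h.differentiableAt_metric hu) y).2
    have e3 : (A u *ᵥ fun p => 2 * quad (christoffelMatrix A p u) y) l =
        2 * (A u *ᵥ fun p => quad (christoffelMatrix A p u) y) l := by
      simp only [Matrix.mulVec, dotProduct, Finset.mul_sum]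
      exact Finset.sum_congr rfl fun j _ => by ring
    simp only [e1, e2, hg, e3, mul_assoc, ← Finset.mul_sum, h.sum_mpd_metric hu]
    ring

theorem hasPd_divergence (hu : u ∈ U) (y : E n) (k : Fin n) :
    HasPd k (fun v => (fun j => ∑ m, christoffel A m m j v) ⬝ᵥ y.ofLp)
      ((fun j => ∑ m, pd k (christoffel A m m j) u) ⬝ᵥ y.ofLp) u :=
  hasPd_dotProduct_left (fun _ => HasPd.sum fun m _ =>
    (h.differentiableAt_christoffel hu m m _).hasPd k) y

omit h in
theorem _root_.Kropina.sum_christoffelMatrix_mulVec (y : E n) :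
    ∑ m, (christoffelMatrix A m u *ᵥ y.ofLp) m =
      (fun j => ∑ m, christoffel A m m j u) ⬝ᵥ y.ofLp := by
  simp only [Matrix.mulVec, dotProduct, Finset.sum_mul, christoffelMatrix, Matrix.of_apply]
  exact Finset.sum_comm

/-- The four groups of terms are arranged as in `ricci_eq_of_spray` for the spray ½ Γ^i_00, so that
the α-part of either curvature can be recognized directly. -/
theorem quad_ricciTensor (hu : u ∈ U) (y : E n) :
    quad (Matrix.of fun j p => ricciTensor A j p u) y =
      ∑ m, quad (mpd m (christoffelMatrix A m) u) y
      - ∑ k, ((fun j => ∑ m, pd k (christoffel A m m j) u) ⬝ᵥ y.ofLp) * y k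
      + ∑ k, quad (christoffelMatrix A k u) y * ∑ m, christoffel A m m k u
      - ∑ m, ∑ k, (christoffelMatrix A m u *ᵥ y.ofLp) k *
          (christoffelMatrix A k u *ᵥ y.ofLp) m := by
  have e1 : ∑ m, quad (mpd m (christoffelMatrix A m) u) y =
      ∑ j, ∑ p, ∑ k, pd k (christoffel A k j p) u * y j * y p := by
    simp only [quad_eq_sum, mpd, Matrix.of_apply, christoffelMatrix]
    rw [Finset.sum_comm]
    exact Finset.sum_congr rfl fun j _ => Finset.sum_comm
  have e2 : ∑ k, ((fun j => ∑ m, pd k (christoffel A m m j) u) ⬝ᵥ y.ofLp) * y k =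
      ∑ j, ∑ p, ∑ k, pd j (christoffel A k k p) u * y j * y p := by
    simp only [dotProduct, Finset.sum_mul]
    exact Finset.sum_congr rfl fun j _ => Finset.sum_congr rfl fun p _ =>
      Finset.sum_congr rfl fun k _ => by ring
  have e3 : ∑ k, quad (christoffelMatrix A k u) y * ∑ m, christoffel A m m k u =
      ∑ j, ∑ p, ∑ k, ∑ m, christoffel A k k m u * christoffel A m j p u * y j * y p := by
    have : ∀ m, quad (christoffelMatrix A m u) y * ∑ k, christoffel A k k m u =
        ∑ k, ∑ j, ∑ p, christoffel A k k m u * christoffel A m j p u * y j * y p := by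
      intro m
      rw [Finset.mul_sum]
      refine Finset.sum_congr rfl fun k _ => ?_
      simp only [quad_eq_sum, christoffelMatrix, Matrix.of_apply, Finset.sum_mul]
      exact Finset.sum_congr rfl fun j _ => Finset.sum_congr rfl fun p _ => by ring
    simp only [this]
    rw [Finset.sum_comm, sum_comm_pairs]
  have e4 : ∑ m, ∑ k, (christoffelMatrix A m u *ᵥ y.ofLp) k *
      (christoffelMatrix A k u *ᵥ y.ofLp) m =
      ∑ j, ∑ p, ∑ k, ∑ m, christoffel A k j m u * christoffel A m k p u * y j * y p := by
    have : ∀ m k, (christoffelMatrix A m u *ᵥ y.ofLp) k * (christoffelMatrix A k u *ᵥ y.ofLp) m =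
        ∑ j, ∑ p, christoffel A m j k u * christoffel A k m p u * y j * y p := by
      intro m k
      simp only [Matrix.mulVec, dotProduct, christoffelMatrix, Matrix.of_apply,
        Finset.sum_mul_sum]
      refine Finset.sum_congr rfl fun j _ => Finset.sum_congr rfl fun p _ => ?_
      rw [h.christoffel_symm hu m j k]
      ring
    simp only [this]
    rw [sum_comm_pairs]
  rw [e1, e2, e3, e4, quad_eq_sum]
  simp only [← Finset.sum_add_distrib, ← Finset.sum_sub_distrib, Matrix.of_apply, ricciTensor,
    curvature, Matrix.add_apply, Matrix.sub_apply, Matrix.mul_apply, mpd, connection,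
    Finset.sum_mul]
  refine Finset.sum_congr rfl fun j _ => Finset.sum_congr rfl fun p _ =>
      Finset.sum_congr rfl fun k _ => ?_
  simp only [Finset.sum_sub_distrib, add_mul, sub_mul, Finset.sum_mul]
  ring

/-- The Ricci curvature of a Riemannian metric. -/
theorem ricci_riemannian {F : E n → E n → ℝ}
    (hF : ∀ v ∈ U, ∀ z, sqF F v z = quad (A v) z) (hu : u ∈ U) (y : E n) :
    ricci F u y = quad (Matrix.of fun j p => ricciTensor A j p u) y := by
  have dC : ∀ v ∈ U, ∀ p i j, DifferentiableAt ℝ (fun w => christoffelMatrix A p w i j) v :=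
    fun v hv p i j => h.differentiableAt_christoffel hv p i j
  rw [ricci_eq_of_spray (Ω := U ×ˢ Set.univ) (u := u) (y := y)
    (H := fun i v z => (1 / 2) * quad (christoffelMatrix A i v) z)
    (Hy := fun i k v z => (christoffelMatrix A i v *ᵥ z.ofLp) k)
    (D := fun v z => (fun j => ∑ m, christoffel A m m j v) ⬝ᵥ z.ofLp)
    (Hx := fun m => (1 / 2) * quad (mpd m (christoffelMatrix A m) u) y)
    (Dx := fun k => (fun j => ∑ m, pd k (christoffel A m m j) u) ⬝ᵥ y.ofLp)
    (Dy := fun k => ∑ m, christoffel A m m k u)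
    (h.isOpen.prod isOpen_univ) ⟨hu, trivial⟩
    (fun v z hv i => h.geodesicCoeff_riemannian hF hv.1 z i)
    (fun v z hv i k => ((hasPd_quad (h.christoffelMatrix_transpose hv.1 i)).const_mul
      (1 / 2)).congr_deriv (by ring))
    (fun m => (hasPd_quad_left (dC u hu m) y).const_mul (1 / 2))
    (fun m => (hasPd_dotProduct_left (c := fun v => christoffelMatrix A m v m)
      (fun j => (dC u hu m m j).hasPd m) y).1)
    (fun m => (hasPd_dotProduct (i := m) (christoffelMatrix A m u m)).1)
    (fun v z hv => sum_christoffelMatrix_mulVec z)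
    (fun k => h.hasPd_divergence hu y k)
    (fun k => hasPd_dotProduct _), h.quad_ricciTensor hu]
  simp only [mul_assoc, ← Finset.mul_sum]
  ring

end MetricOn

end Sprays

/-! ### The Kropina metric of a constant Killing form -/

section LocalKropina

open scoped Matrix

variable {n : ℕ}

/-- The Kropina metric in coordinates. -/
def localKropina (A : E n → Matrix (Fin n) (Fin n) ℝ) (b : E n → Fin n → ℝ) (u y : E n) : ℝ :=
  quad (A u) y / (b u ⬝ᵥ y.ofLp)

variable {U : Set (E n)} {A : E n → Matrix (Fin n) (Fin n) ℝ} {b : E n → Fin n → ℝ} {u : E n}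

theorem HasPd.div_sq {i : Fin n} {q s : E n → ℝ} {q' s' : ℝ} (hq : HasPd i q q' u)
    (hs : HasPd i s s' u) (h0 : s u ≠ 0) :
    HasPd i (fun v => (q v / s v) ^ 2)
      (2 * q u * q' / s u ^ 2 - 2 * q u ^ 2 * s' / s u ^ 3) u := by
  simp only [pow_two (_ / _)]
  exact ((hq.div hs h0).mul (hq.div hs h0)).congr_deriv (by field_simp; ring)

/-- The quotient is ∂F²/∂y^l with q = α², m = a_{l0}, s = β and c = b_l. One formula serves both the
fibre derivatives, which give g, and the base derivatives in the geodesic coefficients. -/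
theorem HasPd.kropina_deriv {i : Fin n} {q m s c : E n → ℝ} {q' m' s' c' : ℝ}
    (hq : HasPd i q q' u) (hm : HasPd i m m' u) (hs : HasPd i s s' u) (hc : HasPd i c c' u)
    (h0 : s u ≠ 0) :
    HasPd i (fun v => (4 * (q v * m v * s v) - 2 * (q v * q v * c v)) / (s v * s v * s v))
      (4 * (q' * m u + q u * m') / s u ^ 2 - 8 * q u * m u * s' / s u ^ 3
        - 4 * q u * q' * c u / s u ^ 3 - 2 * q u ^ 2 * c' / s u ^ 3
        + 6 * q u ^ 2 * c u * s' / s u ^ 4) u := by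
  have hs3 : s u * s u * s u ≠ 0 := mul_ne_zero (mul_ne_zero h0 h0) h0
  exact (((((hq.mul hm).mul hs).const_mul 4).sub (((hq.mul hq).mul hc).const_mul 2)).div
    ((hs.mul hs).mul hs) hs3).congr_deriv (by field_simp; ring)

theorem MetricOn.dotProduct_mulVec_comm (h : MetricOn U A) (hu : u ∈ U) (x z : Fin n → ℝ) :
    (A u *ᵥ x) ⬝ᵥ z = x ⬝ᵥ (A u *ᵥ z) := by
  rw [Matrix.dotProduct_mulVec, ← Matrix.mulVec_transpose, h.transpose_eq hu]

theorem MetricOn.dotProduct_pos (h : MetricOn U A) (hu : u ∈ U) {x : Fin n → ℝ} (hx : x ≠ 0) :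
    0 < x ⬝ᵥ (A u *ᵥ x) := by
  simpa using (h.posDef u hu).dotProduct_mulVec_pos hx

theorem MetricOn.quad_pos (h : MetricOn U A) (hu : u ∈ U) {y : E n} (hy : y ≠ 0) :
    0 < quad (A u) y :=
  h.dotProduct_pos hu fun e => hy (by ext i; exact congrFun e i)

namespace ConstantKillingOn

variable (h : ConstantKillingOn U A b)

include h

theorem isOpen_cone : IsOpen {p : E n × E n | p.1 ∈ U ∧ 0 < b p.1 ⬝ᵥ p.2.ofLp} := by
  have hc : ContinuousOn (fun p : E n × E n => b p.1 ⬝ᵥ p.2.ofLp) (U ×ˢ Set.univ) := by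
    simp only [dotProduct]
    refine continuousOn_finsetSum _ fun i _ => ContinuousOn.mul ?_ ?_
    · exact (h.smoothForm i).continuousOn.comp continuousOn_fst fun p hp => hp.1
    · exact (Continuous.comp (by fun_prop : Continuous fun z : E n => z i)
        continuous_snd).continuousOn
  have := hc.isOpen_inter_preimage (h.isOpen.prod isOpen_univ) (isOpen_Ioi (a := (0 : ℝ)))
  convert this using 1
  ext p
  simp

theorem differentiableAt_form (hu : u ∈ U) (i : Fin n) :
    DifferentiableAt ℝ (fun v => b v i) u :=
  differentiableAt_of_contDiffOn h.isOpen (h.smoothForm i) hu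

/-- Lowering the index of s^i_0 gives the antisymmetric form b_{i|j}, evaluated here on y twice. -/
theorem metric_mulVec_dotProduct_raisedCovDeriv (hu : u ∈ U) (y : E n) :
    (A u *ᵥ y.ofLp) ⬝ᵥ (raisedCovDeriv A b u *ᵥ y.ofLp) = 0 := by
  rw [h.dotProduct_mulVec_comm hu, Matrix.mulVec_mulVec, h.metric_mul_raisedCovDeriv hu]
  have : y.ofLp ⬝ᵥ (covDerivMatrix A b u *ᵥ y.ofLp) =
      -(y.ofLp ⬝ᵥ (covDerivMatrix A b u *ᵥ y.ofLp)) := by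
    conv_lhs => rw [Matrix.dotProduct_mulVec, ← Matrix.mulVec_transpose,
      h.covDerivMatrix_transpose hu, Matrix.neg_mulVec, neg_dotProduct, dotProduct_comm]
  linarith

theorem form_dotProduct_raisedCovDeriv (hu : u ∈ U) (x : Fin n → ℝ) :
    b u ⬝ᵥ (raisedCovDeriv A b u *ᵥ x) = 0 := by
  rw [Matrix.dotProduct_mulVec]
  have : b u ᵥ* raisedCovDeriv A b u = 0 := funext fun j => h.form_mul_raisedCovDeriv hu j
  rw [this, zero_dotProduct]

theorem hasPd_localKropina (hu : u ∈ U) {y : E n} (hy : 0 < b u ⬝ᵥ y.ofLp) (k : Fin n) :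
    HasPd k (localKropina A b u) ((2 * (A u *ᵥ y.ofLp) k * (b u ⬝ᵥ y.ofLp) -
      quad (A u) y * b u k) / (b u ⬝ᵥ y.ofLp) ^ 2) y :=
  (hasPd_quad (h.transpose_eq hu)).div (hasPd_dotProduct (b u)) hy.ne'

variable {F : E n → E n → ℝ}
  (hF : ∀ v ∈ U, ∀ z, 0 < b v ⬝ᵥ z.ofLp → F v z = localKropina A b v z)

include hF

theorem eventually_fiber (hu : u ∈ U) {y : E n} (hy : 0 < b u ⬝ᵥ y.ofLp) :
    ∀ᶠ z in nhds y, 0 < b u ⬝ᵥ z.ofLp ∧ F u z = localKropina A b u z := by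
  have h1 := (Continuous.prodMk_right u).continuousAt.preimage_mem_nhds
    (h.isOpen_cone.mem_nhds (x := (u, y)) ⟨hu, hy⟩)
  filter_upwards [h1] with z hz
  exact ⟨hz.2, hF u hu z hz.2⟩

theorem eventually_base (hu : u ∈ U) {y : E n} (hy : 0 < b u ⬝ᵥ y.ofLp) :
    ∀ᶠ v in nhds u, v ∈ U ∧ 0 < b v ⬝ᵥ y.ofLp ∧ F v y = localKropina A b v y := by
  have h1 := (Continuous.prodMk_left y).continuousAt.preimage_mem_nhds
    (h.isOpen_cone.mem_nhds (x := (u, y)) ⟨hu, hy⟩)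
  filter_upwards [h1] with v hv
  exact ⟨hv.1, hv.2, hF v hv.1 y hv.2⟩

theorem pd_sqF (hu : u ∈ U) {y : E n} (hy : 0 < b u ⬝ᵥ y.ofLp) (l : Fin n) :
    pd l (sqF F u) y = (4 * (quad (A u) y * (A u *ᵥ y.ofLp) l * (b u ⬝ᵥ y.ofLp)) -
      2 * (quad (A u) y * quad (A u) y * b u l)) /
        ((b u ⬝ᵥ y.ofLp) * (b u ⬝ᵥ y.ofLp) * (b u ⬝ᵥ y.ofLp)) := by
  rw [pd_congr (g := fun z => (quad (A u) z / (b u ⬝ᵥ z.ofLp)) ^ 2)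
    ((h.eventually_fiber hF hu hy).mono fun z hz => by simp only [sqF, hz.2, localKropina])]
  rw [((hasPd_quad (h.transpose_eq hu)).div_sq (hasPd_dotProduct (b u)) hy.ne').2]
  field_simp
  ring

theorem fundamentalTensor_kropina (hu : u ∈ U) {y : E n} (hy : 0 < b u ⬝ᵥ y.ofLp)
    (k l : Fin n) :
    fundamentalTensor F u y k l =
      4 * (A u *ᵥ y.ofLp) k * (A u *ᵥ y.ofLp) l / (b u ⬝ᵥ y.ofLp) ^ 2
      + 2 * quad (A u) y * A u k l / (b u ⬝ᵥ y.ofLp) ^ 2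
      - 4 * quad (A u) y * b u k * (A u *ᵥ y.ofLp) l / (b u ⬝ᵥ y.ofLp) ^ 3
      - 4 * quad (A u) y * (A u *ᵥ y.ofLp) k * b u l / (b u ⬝ᵥ y.ofLp) ^ 3
      + 3 * quad (A u) y ^ 2 * b u k * b u l / (b u ⬝ᵥ y.ofLp) ^ 4 := by
  simp only [fundamentalTensor, Matrix.of_apply]
  rw [pd_congr ((h.eventually_fiber hF hu hy).mono fun z hz => h.pd_sqF hF hu hz.1 l)]
  have := ((hasPd_quad (i := k) (y := y) (h.transpose_eq hu)).kropina_deriv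
    (hasPd_dotProduct (A u l)) (hasPd_dotProduct (b u)) (hasPd_const (b u l)) hy.ne').2
  change pd k (fun z => (4 * (quad (A u) z * (A u *ᵥ z.ofLp) l * (b u ⬝ᵥ z.ofLp)) - _) / _) y = _
    at this
  rw [this, h.symm_apply hu k l]
  simp only [Matrix.mulVec]
  ring

theorem fundamentalTensor_mulVec (hu : u ∈ U) {y : E n} (hy : 0 < b u ⬝ᵥ y.ofLp)
    (X : Fin n → ℝ) (k : Fin n) :
    (fundamentalTensor F u y *ᵥ X) k =
      4 * (A u *ᵥ y.ofLp) k * ((A u *ᵥ y.ofLp) ⬝ᵥ X) / (b u ⬝ᵥ y.ofLp) ^ 2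
      + 2 * quad (A u) y * (A u *ᵥ X) k / (b u ⬝ᵥ y.ofLp) ^ 2
      - 4 * quad (A u) y * b u k * ((A u *ᵥ y.ofLp) ⬝ᵥ X) / (b u ⬝ᵥ y.ofLp) ^ 3
      - 4 * quad (A u) y * (A u *ᵥ y.ofLp) k * (b u ⬝ᵥ X) / (b u ⬝ᵥ y.ofLp) ^ 3
      + 3 * quad (A u) y ^ 2 * b u k * (b u ⬝ᵥ X) / (b u ⬝ᵥ y.ofLp) ^ 4 := by
  have e : (fundamentalTensor F u y *ᵥ X) k = ∑ l, fundamentalTensor F u y k l * X l := rfl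
  have e1 : (A u *ᵥ X) k = ∑ l, A u k l * X l := rfl
  have e2 : (A u *ᵥ y.ofLp) ⬝ᵥ X = ∑ l, (A u *ᵥ y.ofLp) l * X l := rfl
  have e3 : b u ⬝ᵥ X = ∑ l, b u l * X l := rfl
  rw [e, e1, e2, e3]
  simp only [h.fundamentalTensor_kropina hF hu hy, Finset.mul_sum, Finset.sum_div,
    ← Finset.sum_add_distrib, ← Finset.sum_sub_distrib]
  exact Finset.sum_congr rfl fun l _ => by ring

/-- The argument shows that g has no isotropic vector: after scaling by β⁴, its quadratic form is a
sum of two nonnegative terms whose common zero is X = 0. -/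
theorem det_fundamentalTensor_ne_zero (hu : u ∈ U) {y : E n} (hy : 0 < b u ⬝ᵥ y.ofLp) :
    (fundamentalTensor F u y).det ≠ 0 := by
  intro hdet
  obtain ⟨X, hX0, hX⟩ := Matrix.exists_mulVec_eq_zero_iff.2 hdet
  apply hX0
  have hy0 : y ≠ 0 := by
    rintro rfl
    simp at hy
  have hq := h.quad_pos hu hy0
  set s := b u ⬝ᵥ y.ofLp with hs
  set q := quad (A u) y with hqd
  set p := (A u *ᵥ y.ofLp) ⬝ᵥ X with hp
  set c := b u ⬝ᵥ X with hc
  set r := X ⬝ᵥ (A u *ᵥ X) with hr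
  have h1 : X ⬝ᵥ (fundamentalTensor F u y *ᵥ X) = 0 := by rw [hX, dotProduct_zero]
  have h2 : X ⬝ᵥ (fundamentalTensor F u y *ᵥ X) = 4 * p ^ 2 / s ^ 2 + 2 * q * r / s ^ 2
      - 8 * q * p * c / s ^ 3 + 3 * q ^ 2 * c ^ 2 / s ^ 4 := by
    have e1 : r = ∑ k, X k * (A u *ᵥ X) k := rfl
    have e2 : p = ∑ k, (A u *ᵥ y.ofLp) k * X k := rfl
    have e3 : c = ∑ k, b u k * X k := rfl
    have e4 : X ⬝ᵥ (fundamentalTensor F u y *ᵥ X) =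
        4 * p / s ^ 2 * ∑ k, (A u *ᵥ y.ofLp) k * X k + 2 * q / s ^ 2 * ∑ k, X k * (A u *ᵥ X) k
        - 4 * q * p / s ^ 3 * ∑ k, b u k * X k
        - 4 * q * c / s ^ 3 * ∑ k, (A u *ᵥ y.ofLp) k * X k
        + 3 * q ^ 2 * c / s ^ 4 * ∑ k, b u k * X k := by
      have e : ∀ k, (fundamentalTensor F u y *ᵥ X) k = _ :=
        h.fundamentalTensor_mulVec hF hu hy X
      change ∑ k, X k * (fundamentalTensor F u y *ᵥ X) k = _
      simp only [e, ← hs, ← hqd, ← hp, ← hc, Finset.mul_sum, ← Finset.sum_add_distrib,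
        ← Finset.sum_sub_distrib]
      exact Finset.sum_congr rfl fun k _ => by ring
    rw [e4, ← e1, ← e2, ← e3]
    ring
  have hyX : y.ofLp ⬝ᵥ (A u *ᵥ X) = p := (h.dotProduct_mulVec_comm hu _ _).symm
  have hXy : X ⬝ᵥ (A u *ᵥ y.ofLp) = p := dotProduct_comm _ _
  have hyy : y.ofLp ⬝ᵥ (A u *ᵥ y.ofLp) = q := rfl
  -- Completing the square gives s⁴ g(X, X) = 2q α²(W) + (2ps − qc)². If it vanishes, then W = 0,
  -- whence sp = cq; together with 2ps = qc this forces c = 0 and so X = 0.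
  set W := s • X - c • y.ofLp with hW
  have hWW : W ⬝ᵥ (A u *ᵥ W) = s ^ 2 * r - 2 * s * c * p + c ^ 2 * q := by
    simp only [hW, Matrix.mulVec_sub, Matrix.mulVec_smul, dotProduct_sub, sub_dotProduct,
      dotProduct_smul, smul_dotProduct, smul_eq_mul, hyX, hXy, hyy, ← hr]
    ring
  have h3 : 2 * q * (W ⬝ᵥ (A u *ᵥ W)) + (2 * p * s - q * c) ^ 2 = 0 := by
    rw [h2] at h1
    have : s ^ 4 * (4 * p ^ 2 / s ^ 2 + 2 * q * r / s ^ 2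
      - 8 * q * p * c / s ^ 3 + 3 * q ^ 2 * c ^ 2 / s ^ 4) = 0 := by rw [h1, mul_zero]
    rw [hWW, ← this]
    field_simp
    ring
  have hW0 : W = 0 := by
    by_contra hne
    have := h.dotProduct_pos hu hne
    nlinarith [sq_nonneg (2 * p * s - q * c), mul_pos hq this]
  rw [hW0] at h3
  have h4 : 2 * p * s - q * c = 0 := by
    simpa using h3
  have h5 : s * p = c * q := by
    have : (A u *ᵥ y.ofLp) ⬝ᵥ W = 0 := by rw [hW0, dotProduct_zero]
    rw [hW, dotProduct_sub, dotProduct_smul, dotProduct_smul, dotProduct_comm _ y.ofLp, hyy] at this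
    simp only [smul_eq_mul, ← hp] at this
    linarith
  have hc0 : c = 0 := by
    have : c * q = 0 := by linarith
    rcases mul_eq_zero.1 this with h0 | h0
    · exact h0
    · exact absurd h0 hq.ne'
  rw [hW, hc0, zero_smul, sub_zero] at hW0
  exact (smul_eq_zero.1 hW0).resolve_left hy.ne'

/-- The geodesic coefficients of the Kropina metric of a constant Killing form. -/
theorem geodesicCoeff_kropina (hu : u ∈ U) {y : E n} (hy : 0 < b u ⬝ᵥ y.ofLp) (i : Fin n) :
    geodesicCoeff F i u y = (1 / 2) * quad (christoffelMatrix A i u) y -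
      (1 / 2) * (localKropina A b u y * (raisedCovDeriv A b u *ᵥ y.ofLp) i) := by
  set w : Fin n → ℝ := fun p => quad (christoffelMatrix A p u) y with hw
  set S0 := raisedCovDeriv A b u *ᵥ y.ofLp with hS0
  set f := localKropina A b u y with hf
  -- The candidate for 4G: 2Γ^i_00 is the part of α, and −2F s^i_0 has to absorb the derivative of
  -- β.
  rw [geodesicCoeff_eq_of_mulVec (X := (2 : ℝ) • w - (2 * f) • S0)
    (h.det_fundamentalTensor_ne_zero hF hu hy)]
  · simp only [Pi.sub_apply, Pi.smul_apply, smul_eq_mul, hw]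
    ring
  · intro l
    have dA := h.differentiableAt_metric hu
    have dm : ∀ k, HasPd k (fun v => (A v *ᵥ y.ofLp) l) ((mpd k A u *ᵥ y.ofLp) l) u := fun k =>
      hasPd_dotProduct_left (c := fun v => A v l) (fun j => (dA l j).hasPd k) y
    have db : ∀ k, HasPd k (fun v => b v ⬝ᵥ y.ofLp)
        ((fun i => pd k (fun v => b v i) u) ⬝ᵥ y.ofLp) u := fun k =>
      hasPd_dotProduct_left (fun j => (h.differentiableAt_form hu j).hasPd k) y
    have e1 : ∀ k, pd k (fun v => pd l (sqF F v) y) u = _ := fun k =>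
      (pd_congr ((h.eventually_base hF hu hy).mono fun v hv => h.pd_sqF hF hv.1 hv.2.1 l)).trans
      ((hasPd_quad_left dA y).kropina_deriv (dm k) (db k)
        ((h.differentiableAt_form hu l).hasPd k) hy.ne').2
    have e2 : pd l (fun v => sqF F v y) u = _ :=
      (pd_congr (g := fun v => (quad (A v) y / (b v ⬝ᵥ y.ofLp)) ^ 2)
        ((h.eventually_base hF hu hy).mono fun v hv => by
          simp only [sqF, hv.2.2, localKropina])).trans
      ((hasPd_quad_left dA y).div_sq (db l) hy.ne').2
    rw [h.fundamentalTensor_mulVec hF hu hy, e2]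
    simp only [e1]
    have f1 := h.sum_mpd_metric hu y l
    have f2 := h.sum_quad_mpd_metric hu y
    -- The left side is dβ contracted with y, in which the Christoffel terms drop out; the Killing
    -- equation makes it 2 b_{l|0}.
    have f3 : ∑ k, pd k (fun v => b v l) u * y k - (fun i => pd l (fun v => b v i) u) ⬝ᵥ y.ofLp =
        2 * (covDerivMatrix A b u *ᵥ y.ofLp) l := by
      simp only [dotProduct, Matrix.mulVec, covDerivMatrix, Matrix.of_apply, Finset.mul_sum,
        ← Finset.sum_sub_distrib]
      refine Finset.sum_congr rfl fun k _ => ?_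
      rw [(h.hasPd_form hu l k).2, (h.hasPd_form hu k l).2, h.covDeriv_antisymm hu k l]
      have : ∑ p, christoffel A p k l u * b u p = ∑ p, christoffel A p l k u * b u p :=
        Finset.sum_congr rfl fun p _ => by rw [h.christoffel_symm hu p k l]
      rw [this]
      ring
    -- By the Killing equation b_{i|k} y^i y^k = 0, so only the Christoffel part of ∂b survives.
    have f4 : ∑ k, ((fun i => pd k (fun v => b v i) u) ⬝ᵥ y.ofLp) * y k = b u ⬝ᵥ w := by
      have g1 : ∑ k, (∑ i, covDeriv A b i k u * y i) * y k = 0 := by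
        have g2 : ∑ k, (∑ i, covDeriv A b i k u * y i) * y k =
            -∑ k, (∑ i, covDeriv A b i k u * y i) * y k := by
          conv_lhs => simp only [Finset.sum_mul]
          rw [Finset.sum_comm, ← Finset.sum_neg_distrib]
          refine Finset.sum_congr rfl fun k _ => ?_
          rw [Finset.sum_mul, ← Finset.sum_neg_distrib]
          refine Finset.sum_congr rfl fun i _ => ?_
          rw [h.covDeriv_antisymm hu k i]
          ring
        linarith
      have g3 : b u ⬝ᵥ w = ∑ k, (∑ i, (∑ p, christoffel A p i k u * b u p) * y i) * y k := by
        simp only [hw, dotProduct, quad_eq_sum, christoffelMatrix, Matrix.of_apply,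
          Finset.mul_sum, Finset.sum_mul]
        rw [Finset.sum_comm_cycle]
        refine Finset.sum_congr rfl fun k _ => ?_
        rw [Finset.sum_comm]
        exact Finset.sum_congr rfl fun i _ => Finset.sum_congr rfl fun p _ => by ring
      have g4 : ∑ k, ((fun i => pd k (fun v => b v i) u) ⬝ᵥ y.ofLp) * y k =
          ∑ k, (∑ i, covDeriv A b i k u * y i) * y k +
          ∑ k, (∑ i, (∑ p, christoffel A p i k u * b u p) * y i) * y k := by
        simp only [dotProduct, fun k i => (h.hasPd_form hu i k).2, add_mul,
          Finset.sum_add_distrib]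
      rw [g3, g4, g1, zero_add]
    -- The vector s^i_0 pairs to zero with both a_{k0} and b_k, so g acts on it only through its
    -- multiple of a_{kl}. This is why a multiple of s^i_0 suffices as correction.
    have f5 : (A u *ᵥ y.ofLp) ⬝ᵥ ((2 : ℝ) • w - (2 * f) • S0) =
        2 * ((A u *ᵥ y.ofLp) ⬝ᵥ w) := by
      rw [dotProduct_sub, dotProduct_smul, dotProduct_smul, hS0,
        h.metric_mulVec_dotProduct_raisedCovDeriv hu]
      simp
    have f6 : b u ⬝ᵥ ((2 : ℝ) • w - (2 * f) • S0) = 2 * (b u ⬝ᵥ w) := by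
      rw [dotProduct_sub, dotProduct_smul, dotProduct_smul, hS0,
        h.form_dotProduct_raisedCovDeriv hu]
      simp
    have f7 : (A u *ᵥ ((2 : ℝ) • w - (2 * f) • S0)) l =
        2 * (A u *ᵥ w) l - 2 * f * (covDerivMatrix A b u *ᵥ y.ofLp) l := by
      rw [Matrix.mulVec_sub, Matrix.mulVec_smul, Matrix.mulVec_smul, hS0, Matrix.mulVec_mulVec,
        h.metric_mul_raisedCovDeriv hu]
      rfl
    rw [f5, f6, f7]
    set s := b u ⬝ᵥ y.ofLp with hs
    set q := quad (A u) y with hq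
    set m := (A u *ᵥ y.ofLp) l with hm
    have f8 : f = q / s := rfl
    have f9 : ∑ k, (4 * (quad (mpd k A u) y * m + q * (mpd k A u *ᵥ y.ofLp) l) / s ^ 2 -
        8 * q * m * ((fun i => pd k (fun v => b v i) u) ⬝ᵥ y.ofLp) / s ^ 3 -
        4 * q * quad (mpd k A u) y * b u l / s ^ 3 - 2 * q ^ 2 * pd k (fun v => b v l) u / s ^ 3 +
        6 * q ^ 2 * b u l * ((fun i => pd k (fun v => b v i) u) ⬝ᵥ y.ofLp) / s ^ 4) * y k =
        4 * m / s ^ 2 * ∑ k, quad (mpd k A u) y * y k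
        + 4 * q / s ^ 2 * ∑ k, (mpd k A u *ᵥ y.ofLp) l * y k
        - 8 * q * m / s ^ 3 * ∑ k, ((fun i => pd k (fun v => b v i) u) ⬝ᵥ y.ofLp) * y k
        - 4 * q * b u l / s ^ 3 * ∑ k, quad (mpd k A u) y * y k
        - 2 * q ^ 2 / s ^ 3 * ∑ k, pd k (fun v => b v l) u * y k
        + 6 * q ^ 2 * b u l / s ^ 4 *
          ∑ k, ((fun i => pd k (fun v => b v i) u) ⬝ᵥ y.ofLp) * y k := by
      simp only [Finset.mul_sum, ← Finset.sum_add_distrib, ← Finset.sum_sub_distrib]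
      exact Finset.sum_congr rfl fun k _ => by ring
    rw [f9, f1, f2, f4, eq_add_of_sub_eq f3, f8]
    field_simp
    ring

end ConstantKillingOn

end LocalKropina

/-! ### Ricci curvature of the Kropina metric -/

section KropinaRicci

open scoped Matrix

variable {n : ℕ}

/-- The derivative `F_{yᵏ}` of the Kropina metric. -/
def kropinaDeriv (A : E n → Matrix (Fin n) (Fin n) ℝ) (b : E n → Fin n → ℝ) (k : Fin n)
    (u y : E n) : ℝ :=
  (2 * (A u *ᵥ y.ofLp) k * (b u ⬝ᵥ y.ofLp) - quad (A u) y * b u k) / (b u ⬝ᵥ y.ofLp) ^ 2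

/-- The vector `bⁱ`. -/
def raiseVec (A : E n → Matrix (Fin n) (Fin n) ℝ) (b : E n → Fin n → ℝ) (u : E n) : E n :=
  WithLp.toLp 2 fun i => raise A b i u

/-- The Ricci tensor as a matrix. -/
def ricciMatrix (A : E n → Matrix (Fin n) (Fin n) ℝ) (u : E n) : Matrix (Fin n) (Fin n) ℝ :=
  Matrix.of fun j p => ricciTensor A j p u

variable {U : Set (E n)} {A : E n → Matrix (Fin n) (Fin n) ℝ} {b : E n → Fin n → ℝ} {u : E n}

/-- This expands ∂G^m/∂y^k · ∂G^k/∂y^m with N = Γ^m_{k0}, p = ∂F/∂y, z = s_0, f = F and S = s. The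
hypothesis kills the square of p · z. -/
theorem sum_sum_mul_swap_of_sum_eq_zero (N S : Fin n → Fin n → ℝ) (p z : Fin n → ℝ) (f : ℝ)
    (hpz : ∑ k, p k * z k = 0) :
    ∑ m, ∑ k, (N m k - (1 / 2) * (p k * z m + f * S m k)) *
      (N k m - (1 / 2) * (p m * z k + f * S k m)) =
    ∑ m, ∑ k, N m k * N k m - ∑ k, (∑ m, N m k * p m) * z k - f * ∑ m, ∑ k, N m k * S k m
      + (1 / 2) * f * ∑ k, p k * ∑ m, S k m * z m
      + (1 / 4) * f ^ 2 * ∑ k, ∑ m, S k m * S m k := by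
  have e1 : ∑ m, ∑ k, N k m * (p k * z m) = ∑ k, (∑ m, N m k * p m) * z k := by
    simp only [Finset.sum_mul]
    exact Finset.sum_congr rfl fun k _ => Finset.sum_congr rfl fun m _ => by ring
  have e2 : ∑ m, ∑ k, N m k * (p m * z k) = ∑ k, (∑ m, N m k * p m) * z k := by
    rw [← e1, Finset.sum_comm]
  have e3 : ∑ m, ∑ k, N k m * S m k = ∑ m, ∑ k, N m k * S k m := Finset.sum_comm
  have e4 : ∑ m, ∑ k, (p k * z k) * (p m * z m) = 0 := by
    simp only [← Finset.sum_mul, hpz, zero_mul, Finset.sum_const_zero]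
  have e5 : ∑ m, ∑ k, p m * (S m k * z k) = ∑ k, p k * ∑ m, S k m * z m := by
    simp only [Finset.mul_sum]
  have e6 : ∑ m, ∑ k, p k * (S k m * z m) = ∑ k, p k * ∑ m, S k m * z m := by
    rw [← e5, Finset.sum_comm]
  have expand : ∀ m k, (N m k - (1 / 2) * (p k * z m + f * S m k)) *
      (N k m - (1 / 2) * (p m * z k + f * S k m)) = N m k * N k m
      - (1 / 2) * (N m k * (p m * z k)) - (1 / 2) * f * (N m k * S k m)
      - (1 / 2) * (N k m * (p k * z m)) - (1 / 2) * f * (N k m * S m k)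
      + (1 / 4) * ((p k * z k) * (p m * z m)) + (1 / 4) * f * (p k * (S k m * z m))
      + (1 / 4) * f * (p m * (S m k * z k)) + (1 / 4) * f ^ 2 * (S m k * S k m) := by
    intro m k
    ring
  simp only [expand, Finset.sum_add_distrib, Finset.sum_sub_distrib, ← Finset.mul_sum, e1, e2, e3,
    e4, e6]
  ring

theorem quad_sub_smul {N : Matrix (Fin n) (Fin n) ℝ} (hN : N.transpose = N) (y v : E n) (c : ℝ) :
    quad N (y - c • v) = quad N y - 2 * c * (y.ofLp ⬝ᵥ (N *ᵥ v.ofLp)) + c ^ 2 * quad N v := by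
  have e : v.ofLp ⬝ᵥ (N *ᵥ y.ofLp) = y.ofLp ⬝ᵥ (N *ᵥ v.ofLp) := by
    rw [Matrix.dotProduct_mulVec, ← Matrix.mulVec_transpose, hN, dotProduct_comm]
  simp only [quad, WithLp.ofLp_sub, WithLp.ofLp_smul, Matrix.mulVec_sub, Matrix.mulVec_smul,
    dotProduct_sub, sub_dotProduct, dotProduct_smul, smul_dotProduct, smul_eq_mul, e]
  ring

theorem MetricOn.ricciMatrix_transpose (h : MetricOn U A) (hu : u ∈ U) :
    (ricciMatrix A u).transpose = ricciMatrix A u := by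
  ext i j
  exact h.ricciTensor_symm hu j i

namespace ConstantKillingOn

variable (h : ConstantKillingOn U A b)

include h

theorem differentiableAt_raisedCovDeriv (hu : u ∈ U) (i j : Fin n) :
    DifferentiableAt ℝ (fun v => raisedCovDeriv A b v i j) u :=
  differentiableAt_of_contDiffOn h.isOpen (h.smooth_raisedCovDeriv i j) hu

/-- In F_{y^k} = 2a_{k0}/β − α² b_k/β² the b-part is annihilated by s^k_j; the a-part lowers the
index, and antisymmetry moves b_{i|j} over to y. -/
theorem sum_kropinaDeriv_mul (hu : u ∈ U) {y : E n} (hy : 0 < b u ⬝ᵥ y.ofLp) (x : Fin n → ℝ) :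
    ∑ k, kropinaDeriv A b k u y * (raisedCovDeriv A b u *ᵥ x) k =
      -(2 / (b u ⬝ᵥ y.ofLp)) * ((covDerivMatrix A b u *ᵥ y.ofLp) ⬝ᵥ x) := by
  have e1 := h.form_dotProduct_raisedCovDeriv hu x
  have e2 : (A u *ᵥ y.ofLp) ⬝ᵥ (raisedCovDeriv A b u *ᵥ x) =
      -((covDerivMatrix A b u *ᵥ y.ofLp) ⬝ᵥ x) := by
    rw [h.dotProduct_mulVec_comm hu, Matrix.mulVec_mulVec, h.metric_mul_raisedCovDeriv hu,
      Matrix.dotProduct_mulVec, ← Matrix.mulVec_transpose, h.covDerivMatrix_transpose hu,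
      Matrix.neg_mulVec, neg_dotProduct]
  have e3 : ∑ k, kropinaDeriv A b k u y * (raisedCovDeriv A b u *ᵥ x) k =
      (2 / (b u ⬝ᵥ y.ofLp)) * ((A u *ᵥ y.ofLp) ⬝ᵥ (raisedCovDeriv A b u *ᵥ x)) -
      quad (A u) y / (b u ⬝ᵥ y.ofLp) ^ 2 * (b u ⬝ᵥ (raisedCovDeriv A b u *ᵥ x)) := by
    generalize raisedCovDeriv A b u *ᵥ x = z
    rw [show (A u *ᵥ y.ofLp) ⬝ᵥ z = ∑ k, (A u *ᵥ y.ofLp) k * z k from rfl,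
      show b u ⬝ᵥ z = ∑ k, b u k * z k from rfl]
    simp only [kropinaDeriv, Finset.mul_sum, ← Finset.sum_sub_distrib]
    exact Finset.sum_congr rfl fun k _ => by field_simp
  rw [e3, e1, e2]
  ring

theorem sum_kropinaDeriv_mul_self (hu : u ∈ U) {y : E n} (hy : 0 < b u ⬝ᵥ y.ofLp) :
    ∑ k, kropinaDeriv A b k u y * (raisedCovDeriv A b u *ᵥ y.ofLp) k = 0 := by
  rw [h.sum_kropinaDeriv_mul hu hy]
  have := h.metric_mulVec_dotProduct_raisedCovDeriv hu y
  rw [h.dotProduct_mulVec_comm hu, Matrix.mulVec_mulVec, h.metric_mul_raisedCovDeriv hu] at this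
  rw [dotProduct_comm (_ *ᵥ _), this, mul_zero]

/-- This is `div_raisedCovDeriv` contracted with y, grouped in the way its terms occur in the Ricci
curvature of the spray. -/
theorem div_raisedCovDeriv_mulVec (hu : u ∈ U) (y : E n) :
    ∑ m, (mpd m (raisedCovDeriv A b) u *ᵥ y.ofLp) m
      + ∑ k, (raisedCovDeriv A b u *ᵥ y.ofLp) k * ∑ m, christoffel A m m k u
      - ∑ m, ∑ k, (christoffelMatrix A m u *ᵥ y.ofLp) k * raisedCovDeriv A b u k m =
      y.ofLp ⬝ᵥ (ricciMatrix A u *ᵥ (raiseVec A b u).ofLp) := by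
  have e0 : y.ofLp ⬝ᵥ (ricciMatrix A u *ᵥ (raiseVec A b u).ofLp) =
      ∑ j, y j * ∑ p, ricciTensor A j p u * raise A b p u := rfl
  rw [e0]
  simp only [← h.div_raisedCovDeriv hu, Finset.sum_add_distrib, Finset.sum_sub_distrib, mul_add,
    mul_sub]
  have e1 : ∑ m, (mpd m (raisedCovDeriv A b) u *ᵥ y.ofLp) m =
      ∑ j, y j * ∑ k, pd k (fun v => raisedCovDeriv A b v k j) u := by
    simp only [Matrix.mulVec, dotProduct, mpd, Matrix.of_apply, Finset.mul_sum]
    rw [Finset.sum_comm]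
    exact Finset.sum_congr rfl fun k _ => Finset.sum_congr rfl fun j _ => by ring
  have e2 : ∑ k, (raisedCovDeriv A b u *ᵥ y.ofLp) k * ∑ m, christoffel A m m k u =
      ∑ j, y j * ∑ k, ∑ m, christoffel A k k m u * raisedCovDeriv A b u m j := by
    have : ∀ k, (raisedCovDeriv A b u *ᵥ y.ofLp) k * ∑ m, christoffel A m m k u =
        ∑ j, ∑ m, raisedCovDeriv A b u k j * y j * christoffel A m m k u :=
      fun k => Finset.sum_mul_sum Finset.univ Finset.univ
        (fun j => raisedCovDeriv A b u k j * y j) (fun m => christoffel A m m k u)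
    simp only [this, Finset.mul_sum]
    rw [Finset.sum_comm]
    refine Finset.sum_congr rfl fun j _ => ?_
    conv_rhs => rw [Finset.sum_comm]
    exact Finset.sum_congr rfl fun k _ => Finset.sum_congr rfl fun m _ => by ring
  have e3 : ∑ m, ∑ k, (christoffelMatrix A m u *ᵥ y.ofLp) k * raisedCovDeriv A b u k m =
      ∑ j, y j * ∑ k, ∑ m, christoffel A m k j u * raisedCovDeriv A b u k m := by
    simp only [Matrix.mulVec, dotProduct, Finset.mul_sum, Finset.sum_mul, christoffelMatrix,
      Matrix.of_apply]
    rw [Finset.sum_comm]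
    conv_rhs => rw [Finset.sum_comm]
    refine Finset.sum_congr rfl fun k _ => ?_
    conv_rhs => rw [Finset.sum_comm]
    exact Finset.sum_congr rfl fun m _ => Finset.sum_congr rfl fun j _ => by ring
  rw [e1, e2, e3]
  ring

/-- The horizontal derivative of the Kropina metric. -/
theorem kropina_horizontal_deriv (hu : u ∈ U) {y : E n} (hy : 0 < b u ⬝ᵥ y.ofLp) (k : Fin n) :
    (quad (mpd k A u) y * (b u ⬝ᵥ y.ofLp) -
      quad (A u) y * ((fun i => pd k (fun v => b v i) u) ⬝ᵥ y.ofLp)) / (b u ⬝ᵥ y.ofLp) ^ 2 -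
      ∑ m, (christoffelMatrix A m u *ᵥ y.ofLp) k * kropinaDeriv A b m u y =
      quad (A u) y / (b u ⬝ᵥ y.ofLp) ^ 2 * (covDerivMatrix A b u *ᵥ y.ofLp) k := by
  have e1 : ((fun i => pd k (fun v => b v i) u) ⬝ᵥ y.ofLp) =
      -(covDerivMatrix A b u *ᵥ y.ofLp) k +
        ∑ m, (christoffelMatrix A m u *ᵥ y.ofLp) k * b u m := by
    have : ∑ m, (christoffelMatrix A m u *ᵥ y.ofLp) k * b u m =
        ∑ i, (∑ p, christoffel A p i k u * b u p) * y i := by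
      simp only [Matrix.mulVec, dotProduct, christoffelMatrix, Matrix.of_apply, Finset.sum_mul]
      rw [Finset.sum_comm]
      refine Finset.sum_congr rfl fun i _ => Finset.sum_congr rfl fun p _ => ?_
      rw [h.christoffel_symm hu p k i]
      ring
    rw [this]
    simp only [dotProduct, Matrix.mulVec, covDerivMatrix, Matrix.of_apply,
      ← Finset.sum_neg_distrib, ← Finset.sum_add_distrib]
    refine Finset.sum_congr rfl fun i _ => ?_
    rw [(h.hasPd_form hu i k).2, h.covDeriv_antisymm hu i k]
    ring
  have e2 : ∑ m, (christoffelMatrix A m u *ᵥ y.ofLp) k * kropinaDeriv A b m u y =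
      2 / (b u ⬝ᵥ y.ofLp) * ∑ m, (christoffelMatrix A m u *ᵥ y.ofLp) k * (A u *ᵥ y.ofLp) m -
      quad (A u) y / (b u ⬝ᵥ y.ofLp) ^ 2 *
        ∑ m, (christoffelMatrix A m u *ᵥ y.ofLp) k * b u m := by
    simp only [Finset.mul_sum, ← Finset.sum_sub_distrib, kropinaDeriv]
    exact Finset.sum_congr rfl fun m _ => by field_simp
  -- The terms from α² cancel since it is horizontally constant; what is left is the covariant
  -- derivative of β in the denominator.
  rw [e1, e2, h.quad_mpd_metric hu]
  field_simp
  ring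

/-- The Ricci curvature of the Kropina metric of a constant Killing form. -/
theorem ricci_kropina {F : E n → E n → ℝ}
    (hF : ∀ v ∈ U, ∀ z, 0 < b v ⬝ᵥ z.ofLp → F v z = localKropina A b v z)
    (hu : u ∈ U) {y : E n} (hy : 0 < b u ⬝ᵥ y.ofLp) :
    ricci F u y = quad (ricciMatrix A u) (y - (localKropina A b u y / 2) • raiseVec A b u) := by
  have dC : ∀ v ∈ U, ∀ p i j, DifferentiableAt ℝ (fun w => christoffelMatrix A p w i j) v :=
    fun v hv p i j => h.differentiableAt_christoffel hv p i j
  have dA := h.differentiableAt_metric hu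
  have dS := h.differentiableAt_raisedCovDeriv hu
  have xm : ∀ l k, HasPd k (fun v => (A v *ᵥ y.ofLp) l) ((mpd k A u *ᵥ y.ofLp) l) u := fun l k =>
    hasPd_dotProduct_left (c := fun v => A v l) (fun j => (dA l j).hasPd k) y
  have xS : ∀ l k, HasPd k (fun v => (raisedCovDeriv A b v *ᵥ y.ofLp) l)
      ((mpd k (raisedCovDeriv A b) u *ᵥ y.ofLp) l) u := fun l k =>
    hasPd_dotProduct_left (c := fun v => raisedCovDeriv A b v l) (fun j => (dS l j).hasPd k) y
  have xb : ∀ k, HasPd k (fun v => b v ⬝ᵥ y.ofLp)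
      ((fun i => pd k (fun v => b v i) u) ⬝ᵥ y.ofLp) u := fun k =>
    hasPd_dotProduct_left (fun j => (h.differentiableAt_form hu j).hasPd k) y
  have xF : ∀ k, HasPd k (fun v => localKropina A b v y)
      ((quad (mpd k A u) y * (b u ⬝ᵥ y.ofLp) -
      quad (A u) y * ((fun i => pd k (fun v => b v i) u) ⬝ᵥ y.ofLp)) / (b u ⬝ᵥ y.ofLp) ^ 2) u :=
    fun k => (hasPd_quad_left dA y).div (xb k) hy.ne'
  have yS : ∀ v (z : E n) l k, HasPd k (fun z => (raisedCovDeriv A b v *ᵥ z.ofLp) l)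
      (raisedCovDeriv A b v l k) z := fun v z l k => hasPd_dotProduct (raisedCovDeriv A b v l)
  have hs2 : (b u ⬝ᵥ y.ofLp) ^ 2 ≠ 0 := pow_ne_zero 2 hy.ne'
  rw [ricci_eq_of_spray (Ω := {p : E n × E n | p.1 ∈ U ∧ 0 < b p.1 ⬝ᵥ p.2.ofLp}) (u := u) (y := y)
    (H := fun i v z => (1 / 2) * quad (christoffelMatrix A i v) z -
      (1 / 2) * (localKropina A b v z * (raisedCovDeriv A b v *ᵥ z.ofLp) i))
    (Hy := fun i k v z => (christoffelMatrix A i v *ᵥ z.ofLp) k -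
      (1 / 2) * (kropinaDeriv A b k v z * (raisedCovDeriv A b v *ᵥ z.ofLp) i +
        localKropina A b v z * raisedCovDeriv A b v i k))
    (D := fun v z => (fun j => ∑ m, christoffel A m m j v) ⬝ᵥ z.ofLp)
    (Hx := fun m => (1 / 2) * quad (mpd m (christoffelMatrix A m) u) y -
      (1 / 2) * (((quad (mpd m A u) y * (b u ⬝ᵥ y.ofLp) -
      quad (A u) y * ((fun i => pd m (fun v => b v i) u) ⬝ᵥ y.ofLp)) / (b u ⬝ᵥ y.ofLp) ^ 2) *
        (raisedCovDeriv A b u *ᵥ y.ofLp) m + localKropina A b u y *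
          (mpd m (raisedCovDeriv A b) u *ᵥ y.ofLp) m))
    (Dx := fun k => (fun j => ∑ m, pd k (christoffel A m m j) u) ⬝ᵥ y.ofLp)
    (Dy := fun k => ∑ m, christoffel A m m k u)
    h.isOpen_cone ⟨hu, hy⟩
    (fun v z hv i => h.geodesicCoeff_kropina hF hv.1 hv.2 i)
    (fun v z hv i k => (((hasPd_quad (h.christoffelMatrix_transpose hv.1 i)).const_mul
      (1 / 2)).sub (((h.hasPd_localKropina hv.1 hv.2 k).mul (yS v z i k)).const_mul
        (1 / 2))).congr_deriv (by simp only [kropinaDeriv]; ring))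
    (fun m => ((hasPd_quad_left (dC u hu m) y).const_mul (1 / 2)).sub
      (((xF m).mul (xS m m)).const_mul (1 / 2)))
    (fun m => ((hasPd_dotProduct_left (c := fun v => christoffelMatrix A m v m)
      (fun j => (dC u hu m m j).hasPd m) y).sub
      ((((((((xm m m).const_mul 2).mul (xb m)).sub ((hasPd_quad_left dA y).mul
        ((h.differentiableAt_form hu m).hasPd m))).div (((xb m).mul (xb m)))
        (mul_ne_zero hy.ne' hy.ne')).mul (xS m m)).add
        ((xF m).mul ((dS m m).hasPd m))).const_mul (1 / 2))).1.congr_of_eventuallyEq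
        (Filter.Eventually.of_forall fun v => by simp only [kropinaDeriv, pow_two]; rfl))
    (fun m => ((hasPd_dotProduct (i := m) (christoffelMatrix A m u m)).sub
      ((((((((hasPd_dotProduct (A u m)).const_mul 2).mul (hasPd_dotProduct (b u))).sub
        ((hasPd_quad (h.transpose_eq hu)).mul (hasPd_const (b u m)))).div
        ((hasPd_dotProduct (b u)).mul (hasPd_dotProduct (b u)))
        (mul_ne_zero hy.ne' hy.ne')).mul (yS u y m m)).add
        ((h.hasPd_localKropina hu hy m).mul
          (hasPd_const (raisedCovDeriv A b u m m)))).const_mul (1 / 2))).1.congr_of_eventuallyEq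
        (Filter.Eventually.of_forall fun v => by simp only [kropinaDeriv, pow_two]; rfl))
    -- The y-divergence equals that of the spray of α: F_{y^m} s^m_0 = 0 and s^m_m = 0.
    (fun v z hv => by
      rw [Finset.sum_sub_distrib, sum_christoffelMatrix_mulVec, ← Finset.mul_sum,
        Finset.sum_add_distrib, h.sum_kropinaDeriv_mul_self hv.1 hv.2, ← Finset.mul_sum,
        h.trace_raisedCovDeriv hv.1]
      ring)
    (fun k => h.hasPd_divergence hu y k)
    (fun k => hasPd_dotProduct _),
    quad_sub_smul (h.ricciMatrix_transpose hu), ricciMatrix, h.quad_ricciTensor hu]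
  have q1 := h.div_raisedCovDeriv_mulVec hu y
  have q2 : quad (ricciMatrix A u) (raiseVec A b u) =
      -∑ k, ∑ m, raisedCovDeriv A b u k m * raisedCovDeriv A b u m k := by
    rw [← h.ricci_raise_raise hu, quad_eq_sum]
    rfl
  have q3 := h.sum_kropinaDeriv_mul hu hy (raisedCovDeriv A b u *ᵥ y.ofLp)
  have q4 := h.sum_kropinaDeriv_mul_self hu hy
  have q5 := fun k => eq_add_of_sub_eq (h.kropina_horizontal_deriv hu hy k)
  rw [sum_sum_mul_swap_of_sum_eq_zero (fun m k => (christoffelMatrix A m u *ᵥ y.ofLp) k)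
    (raisedCovDeriv A b u) (fun k => kropinaDeriv A b k u y)
    (raisedCovDeriv A b u *ᵥ y.ofLp) _ q4]
  change ∑ k, kropinaDeriv A b k u y * ∑ m, raisedCovDeriv A b u k m *
    (raisedCovDeriv A b u *ᵥ y.ofLp) m = _ at q3
  have q6 : ∑ k, (covDerivMatrix A b u *ᵥ y.ofLp) k * (raisedCovDeriv A b u *ᵥ y.ofLp) k =
    (covDerivMatrix A b u *ᵥ y.ofLp) ⬝ᵥ (raisedCovDeriv A b u *ᵥ y.ofLp) := rfl
  simp only [ricciMatrix] at q1 q2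
  rw [q3, q2, ← q1]
  -- The horizontal derivative of F contributes −(α²/β²) b_{k|0} s^k_0, and the term ½ F F_{y^k}
  -- s^k_m s^m_0 of the product, through q3, contributes its opposite. The terms of degree 0, 1 and
  -- 2 in F that remain are the expansion of Ric_α at y − (F/2) b♯.
  simp only [q5, sub_mul, add_mul, Finset.sum_add_distrib, Finset.sum_sub_distrib,
    ← Finset.mul_sum, mul_assoc, q6]
  simp only [localKropina]
  field_simp
  ring

end ConstantKillingOn

end KropinaRicci

/-! ### Einstein scalars of `α` and `F` at a point -/

section Pointwise

open scoped Matrix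

variable {n : ℕ} {U : Set (E n)} {A : E n → Matrix (Fin n) (Fin n) ℝ} {b : E n → Fin n → ℝ}
  {u : E n}

theorem eq_of_quad_eq {N P : Matrix (Fin n) (Fin n) ℝ} (hN : N.transpose = N)
    (hP : P.transpose = P) (h : ∀ z, quad N z = quad P z) : N = P := by
  have key : ∀ (Q : Matrix (Fin n) (Fin n) ℝ), Q.transpose = Q → ∀ i j,
      2 * Q i j = quad Q (EuclideanSpace.single i 1) + quad Q (EuclideanSpace.single j 1)
        - quad Q (EuclideanSpace.single i 1 - (1 : ℝ) • EuclideanSpace.single j 1) := by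
    intro Q hQ i j
    rw [quad_sub_smul hQ]
    simp
  ext i j
  have h1 := key N hN i j
  have h2 := key P hP i j
  rw [h, h, h, ← h2] at h1
  linarith

theorem quad_smul (N : Matrix (Fin n) (Fin n) ℝ) (c : ℝ) (z : E n) :
    quad N (c • z) = c ^ 2 * quad N z := by
  simp only [quad, WithLp.ofLp_smul, Matrix.mulVec_smul, dotProduct_smul, smul_dotProduct,
    smul_eq_mul]
  ring

theorem form_dotProduct_raiseVec : b u ⬝ᵥ (raiseVec A b u).ofLp = coordNormSq A b u :=
  dotProduct_comm _ _

namespace MetricOn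

variable (h : MetricOn U A)

include h

theorem mulVec_raiseVec (hu : u ∈ U) : A u *ᵥ (raiseVec A b u).ofLp = b u :=
  funext fun k => h.lower_raise hu k

theorem quad_raiseVec (hu : u ∈ U) : quad (A u) (raiseVec A b u) = coordNormSq A b u := by
  rw [quad, h.mulVec_raiseVec hu]
  rfl

theorem coordNormSq_pos (hu : u ∈ U) (hb : b u ≠ 0) : 0 < coordNormSq A b u := by
  rw [← h.quad_raiseVec hu]
  refine h.quad_pos hu fun e => hb ?_
  rw [← h.mulVec_raiseVec (b := b) hu, e]
  simp

theorem quad_sub_raiseVec (hu : u ∈ U) (y : E n) (c : ℝ) :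
    quad (A u) (y - c • raiseVec A b u) =
      quad (A u) y - 2 * c * (b u ⬝ᵥ y.ofLp) + c ^ 2 * coordNormSq A b u := by
  rw [quad_sub_smul (h.transpose_eq hu), h.mulVec_raiseVec hu, h.quad_raiseVec hu,
    dotProduct_comm y.ofLp]

/-- Since α² = Fβ, the first two terms of α² − Fβ + F² b²/4 cancel. Geometrically, the indicatrix of
F is part of an α-sphere of radius b/2 centred at b♯/2. -/
theorem quad_indicatrix (hu : u ∈ U) {y : E n} (hy : 0 < b u ⬝ᵥ y.ofLp) :
    quad (A u) (y - (localKropina A b u y / 2) • raiseVec A b u) =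
      localKropina A b u y ^ 2 * coordNormSq A b u / 4 := by
  have e : quad (A u) y = localKropina A b u y * (b u ⬝ᵥ y.ofLp) :=
    (div_mul_cancel₀ _ hy.ne').symm
  rw [h.quad_sub_raiseVec hu, e]
  ring

theorem exists_indicatrix (hu : u ∈ U) (hb : b u ≠ 0) {z : E n} (hz : z ≠ 0)
    (hbz : 0 ≤ b u ⬝ᵥ z.ofLp) :
    ∃ y : E n, 0 < b u ⬝ᵥ y.ofLp ∧
      y - (localKropina A b u y / 2) • raiseVec A b u = z ∧
      quad (A u) z = localKropina A b u y ^ 2 * coordNormSq A b u / 4 := by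
  have hB := h.coordNormSq_pos hu hb
  have hq := h.quad_pos hu hz
  set B := coordNormSq A b u with hBd
  set q := quad (A u) z with hqd
  -- The value F(y) is forced by `quad_indicatrix`: F² b² = 4α²(z). Then y must be z + (f/2) b♯, and
  -- β(z) ≥ 0 gives β(y) ≥ (f/2) b² > 0.
  set f := 2 * √(q / B) with hf
  have hf0 : 0 < f := by positivity
  have hf2 : f ^ 2 * B = 4 * q := by
    rw [hf, mul_pow, Real.sq_sqrt (by positivity)]
    field_simp
    ring
  -- The double negative puts y in the shape required by `quad_sub_raiseVec`.
  set y := z - (-(f / 2)) • raiseVec A b u with hyd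
  have hby : b u ⬝ᵥ y.ofLp = b u ⬝ᵥ z.ofLp + f / 2 * B := by
    simp only [hyd, WithLp.ofLp_sub, WithLp.ofLp_smul, dotProduct_sub, dotProduct_smul,
      form_dotProduct_raiseVec, smul_eq_mul]
    ring
  have hpos : 0 < b u ⬝ᵥ y.ofLp := by
    rw [hby]
    positivity
  have hK : localKropina A b u y = f := by
    rw [localKropina, div_eq_iff hpos.ne', hby, hyd, h.quad_sub_raiseVec hu]
    linear_combination (-(1 : ℝ) / 4) * hf2
  refine ⟨y, hpos, ?_, ?_⟩
  · rw [hK, hyd]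
    module
  · rw [hK, hf2]
    ring

theorem quad_eq_of_kropina_einstein (hu : u ∈ U) (hb : b u ≠ 0)
    {N : Matrix (Fin n) (Fin n) ℝ} {σ : ℝ}
    (hN : ∀ y : E n, 0 < b u ⬝ᵥ y.ofLp →
      quad N (y - (localKropina A b u y / 2) • raiseVec A b u) = σ * localKropina A b u y ^ 2)
    (z : E n) : quad N z = 4 * σ / coordNormSq A b u * quad (A u) z := by
  have hB := h.coordNormSq_pos hu hb
  have key : ∀ z : E n, z ≠ 0 → 0 ≤ b u ⬝ᵥ z.ofLp →
      quad N z = 4 * σ / coordNormSq A b u * quad (A u) z := by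
    intro z hz hbz
    obtain ⟨y, hy, hyz, hq⟩ := h.exists_indicatrix hu hb hz hbz
    have h1 := hN y hy
    rw [hyz] at h1
    rw [h1, hq]
    field_simp
  by_cases hz : z = 0
  · subst hz
    simp [quad]
  -- Vectors with β(z) ≤ 0 are handled by passing to −z, which changes neither quadratic form.
  rcases le_total 0 (b u ⬝ᵥ z.ofLp) with hbz | hbz
  · exact key z hz hbz
  · have h1 := key ((-1 : ℝ) • z) (by simpa using hz) (by
      simp only [WithLp.ofLp_smul, dotProduct_smul, smul_eq_mul]
      linarith)
    rw [quad_smul, quad_smul] at h1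
    linarith

end MetricOn

theorem ConstantKillingOn.quad_ricciMatrix_raiseVec_nonneg (h : ConstantKillingOn U A b)
    (hu : u ∈ U) : 0 ≤ quad (ricciMatrix A u) (raiseVec A b u) := by
  rw [quad_eq_sum]
  exact h.ricci_raise_raise_nonneg hu

theorem eqOn_ball_of_pd_eq_zero {f : E n → ℝ} {r : ℝ} {x : E n}
    (hf : ∀ v ∈ Metric.ball x r, DifferentiableAt ℝ f v)
    (hd : ∀ v ∈ Metric.ball x r, ∀ i, pd i f v = 0) {v : E n} (hv : v ∈ Metric.ball x r) :
    f v = f x := by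
  have hr : 0 < r := Metric.pos_of_mem_ball hv
  refine Metric.isOpen_ball.is_const_of_fderiv_eq_zero (𝕜 := ℝ)
    (convex_ball x r).isPreconnected (fun w hw => (hf w hw).differentiableWithinAt) ?_ hv
    (Metric.mem_ball_self hr)
  intro w hw
  have : (fderiv ℝ f w).toLinearMap = 0 := by
    refine (EuclideanSpace.basisFun (Fin n) ℝ).toBasis.ext fun i => ?_
    simpa [pd] using hd w hw i
  ext z
  exact LinearMap.congr_fun this z

end Pointwise

/-! ### From the manifold to charts -/

section Charts

open scoped Matrix

variable {n : ℕ} {M : Type*} [TopologicalSpace M] [ChartedSpace (E n) M]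
  [IsManifold (𝓡 n) ∞ M] (a : RMetric n M) (β : OneForm n M)
  {φ : OpenPartialHomeomorph M (E n)}

theorem inner_coordVec (u y z : E n) :
    a.inner (φ.symm u) (coordVec φ u y) (coordVec φ u z) =
      y.ofLp ⬝ᵥ (metricMatrix a φ u *ᵥ z.ofLp) := by
  rw [coordVec_linear φ u y, coordVec_linear φ u z]
  simp only [map_sum, map_smul, FunLike.coe_sum, Finset.sum_apply,
    FunLike.coe_smul, Pi.smul_apply, smul_eq_mul, dotProduct, Matrix.mulVec,
    metricMatrix, Matrix.of_apply, Finset.mul_sum]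
  rw [Finset.sum_comm]
  exact Finset.sum_congr rfl fun i _ => Finset.sum_congr rfl fun j _ => by ring

theorem form_coordVec (u y : E n) :
    β.toFun (φ.symm u) (coordVec φ u y) = formCoeff β φ u ⬝ᵥ y.ofLp := by
  rw [coordVec_linear φ u y]
  simp only [map_sum, map_smul, smul_eq_mul, dotProduct, formCoeff]
  exact Finset.sum_congr rfl fun i _ => mul_comm _ _

theorem sqF_inChart_alpha (u y : E n) :
    sqF (inChart (alpha a) φ) u y = quad (metricMatrix a φ u) y := by
  have h0 : 0 ≤ a.inner (φ.symm u) (coordVec φ u y) (coordVec φ u y) := by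
    by_cases hv : coordVec φ u y = 0
    · simp [hv]
    · exact (a.pos _ _ hv).le
  rw [sqF, inChart, alpha, Real.sq_sqrt h0, inner_coordVec]
  rfl

theorem inChart_kropina (u y : E n) :
    inChart (kropina a β) φ u y = localKropina (metricMatrix a φ) (formCoeff β φ) u y := by
  have h1 := sqF_inChart_alpha a (φ := φ) u y
  rw [sqF, inChart] at h1
  rw [inChart, kropina, h1, form_coordVec, localKropina]

theorem coordVec_mem_posCone (u y : E n) :
    coordVec φ u y ∈ posCone β (φ.symm u) ↔ 0 < formCoeff β φ u ⬝ᵥ y.ofLp := by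
  rw [← form_coordVec]
  rfl

variable (hφ : φ ∈ IsManifold.maximalAtlas (𝓡 n) ∞ M)

include hφ

omit [IsManifold (𝓡 n) ∞ M] in
theorem coordVec_ne_zero {u y : E n} (hu : u ∈ φ.target) (hy : y ≠ 0) : coordVec φ u y ≠ 0 := by
  intro h0
  apply hy
  apply coordVec_injective hφ hu
  rw [h0, coordVec_linear φ u 0]
  simp

theorem metricOn_chart : MetricOn φ.target (metricMatrix a φ) where
  isOpen := φ.open_target
  smooth := contDiffOn_metricMatrix a hφ
  posDef u hu := by
    refine Matrix.PosDef.of_dotProduct_mulVec_pos ?_ fun x hx => ?_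
    · ext i j
      exact a.symm _ _ _
    · have h1 := inner_coordVec a (φ := φ) u (WithLp.toLp 2 x) (WithLp.toLp 2 x)
      have h2 := a.pos _ _ (coordVec_ne_zero hφ hu (y := WithLp.toLp 2 x)
        (fun e => hx (by simpa using e)))
      rw [h1] at h2
      exact h2

theorem constantKillingOn_chart (hK : IsConstantKilling a β) :
    ConstantKillingOn φ.target (metricMatrix a φ) (formCoeff β φ) where
  toMetricOn := metricOn_chart a hφ
  smoothForm := contDiffOn_formCoeff β hφ
  killing u hu := (hK φ hφ u hu).1
  sForm_eq_zero u hu := (hK φ hφ u hu).2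

theorem formCoeff_ne_zero (hβ : ∀ x, β.toFun x ≠ 0) {u : E n}
    (hu : u ∈ φ.target) : formCoeff β φ u ≠ 0 := by
  intro h0
  apply hβ (φ.symm u)
  ext v
  obtain ⟨y, rfl⟩ := coordVec_surjective hφ hu v
  rw [form_coordVec, h0, zero_dotProduct]
  rfl

/-- This expresses b² through the metric dual w of β, a characterization free of coordinates;
positive definiteness makes w unique, so b² agrees in all charts. -/
theorem exists_dual_coordNormSq {u : E n} (hu : u ∈ φ.target) {x : M} (hx : φ.symm u = x) :
    ∃ w : TangentSpace (𝓡 n) x, (∀ v, a.inner x w v = β.toFun x v) ∧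
      coordNormSq (metricMatrix a φ) (formCoeff β φ) u = β.toFun x w := by
  subst hx
  have hm := metricOn_chart a hφ
  refine ⟨coordVec φ u (raiseVec (metricMatrix a φ) (formCoeff β φ) u), fun v => ?_, ?_⟩
  · obtain ⟨y, rfl⟩ := coordVec_surjective hφ hu v
    rw [inner_coordVec, form_coordVec, ← hm.dotProduct_mulVec_comm hu, hm.mulVec_raiseVec hu]
  · rw [form_coordVec, form_dotProduct_raiseVec]

/-- `b²` does not depend on the chart. -/
theorem coordNormSq_eq_normSq {u : E n} (hu : u ∈ φ.target) :
    coordNormSq (metricMatrix a φ) (formCoeff β φ) u = normSq a β (φ.symm u) := by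
  set x := φ.symm u with hx
  obtain ⟨w, hw, e⟩ := exists_dual_coordNormSq a β hφ hu hx.symm
  obtain ⟨w', hw', e'⟩ := exists_dual_coordNormSq a β
    (IsManifold.chart_mem_maximalAtlas (I := 𝓡 n) (n := ∞) x)
    (mem_chart_target (E n) x) (OpenPartialHomeomorph.left_inv _ (mem_chart_source (E n) x))
  have hww : w = w' := by
    by_contra hne
    have h1 := a.pos x (w - w') (sub_ne_zero.2 hne)
    have h2 : a.inner x (w - w') (w - w') =
        a.inner x w (w - w') - a.inner x w' (w - w') := by
      rw [map_sub (a.inner x) w w']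
      rfl
    rw [h2, hw, hw', sub_self] at h1
    exact h1.false
  rw [e, hww, ← e']
  rfl

end Charts

/-! ### Transfer of the Einstein condition between α and F on the manifold -/

section Einstein

open scoped Matrix

variable {n : ℕ} {M : Type*} [TopologicalSpace M] [ChartedSpace (E n) M]
  [IsManifold (𝓡 n) ∞ M] {a : RMetric n M} {β : OneForm n M}
  {φ : OpenPartialHomeomorph M (E n)}

theorem ricci_alpha (hφ : φ ∈ IsManifold.maximalAtlas (𝓡 n) ∞ M) {u : E n} (hu : u ∈ φ.target)
    (y : E n) : ricci (inChart (alpha a) φ) u y = quad (ricciMatrix (metricMatrix a φ) u) y :=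
  (metricOn_chart a hφ).ricci_riemannian (fun v _ z => sqF_inChart_alpha a v z) hu y

theorem ricci_kropina_chart (hK : IsConstantKilling a β)
    (hφ : φ ∈ IsManifold.maximalAtlas (𝓡 n) ∞ M) {u : E n} (hu : u ∈ φ.target)
    {y : E n} (hy : 0 < formCoeff β φ u ⬝ᵥ y.ofLp) :
    ricci (inChart (kropina a β) φ) u y = quad (ricciMatrix (metricMatrix a φ) u)
      (y - (localKropina (metricMatrix a φ) (formCoeff β φ) u y / 2) •
        raiseVec (metricMatrix a φ) (formCoeff β φ) u) :=
  (constantKillingOn_chart a β hφ hK).ricci_kropina (fun v _ z _ => inChart_kropina a β v z) hu hy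

theorem HasEinsteinScalar.quad_ricciMatrix {lam : M → ℝ} (h : HasEinsteinScalar (alpha a) slit lam)
    (hφ : φ ∈ IsManifold.maximalAtlas (𝓡 n) ∞ M) {u : E n} (hu : u ∈ φ.target) (z : E n) :
    quad (ricciMatrix (metricMatrix a φ) u) z =
      lam (φ.symm u) * quad (metricMatrix a φ u) z := by
  by_cases hz : z = 0
  · subst hz
    simp [quad]
  · rw [← ricci_alpha hφ hu, h φ hφ u hu z (coordVec_ne_zero hφ hu hz), ← sqF_inChart_alpha]
    rfl

theorem HasEinsteinScalar.kropina_of_alpha (hK : IsConstantKilling a β) {lam : M → ℝ}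
    (h : HasEinsteinScalar (alpha a) slit lam) :
    HasEinsteinScalar (kropina a β) (posCone β) (fun x => (1 / 4) * lam x * normSq a β x) := by
  intro φ hφ u hu y hy
  rw [coordVec_mem_posCone] at hy
  rw [ricci_kropina_chart hK hφ hu hy, h.quad_ricciMatrix hφ hu,
    (metricOn_chart a hφ).quad_indicatrix hu hy, inChart_kropina,
    coordNormSq_eq_normSq a β hφ hu]
  ring

theorem HasEinsteinScalar.alpha_of_kropina (hβ : ∀ x : M, β.toFun x ≠ 0)
    (hK : IsConstantKilling a β) {σ : M → ℝ}
    (h : HasEinsteinScalar (kropina a β) (posCone β) σ) :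
    HasEinsteinScalar (alpha a) slit (fun x => 4 * σ x / normSq a β x) := by
  intro φ hφ u hu y _
  have h1 := (metricOn_chart a hφ).quad_eq_of_kropina_einstein hu (formCoeff_ne_zero β hφ hβ hu)
    (N := ricciMatrix (metricMatrix a φ) u) (σ := σ (φ.symm u)) (fun z hz => by
      rw [← ricci_kropina_chart hK hφ hu hz,
        h φ hφ u hu z ((coordVec_mem_posCone β u z).2 hz), inChart_kropina]) y
  rw [ricci_alpha hφ hu, h1, coordNormSq_eq_normSq a β hφ hu, ← sqF_inChart_alpha]
  rfl

theorem exists_chart_point (x : M) :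
    ∃ φ ∈ IsManifold.maximalAtlas (𝓡 n) ∞ M, ∃ u ∈ φ.target, φ.symm u = x ∧ x ∈ φ.source ∧
      φ x = u :=
  ⟨chartAt (E n) x, IsManifold.chart_mem_maximalAtlas x, chartAt (E n) x x,
    mem_chart_target (E n) x, OpenPartialHomeomorph.left_inv _ (mem_chart_source (E n) x),
    mem_chart_source (E n) x, rfl⟩

theorem normSq_pos (hβ : ∀ x : M, β.toFun x ≠ 0) (x : M) : 0 < normSq a β x := by
  obtain ⟨φ, hφ, u, hu, rfl, -⟩ := exists_chart_point (n := n) x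
  rw [← coordNormSq_eq_normSq a β hφ hu]
  exact (metricOn_chart a hφ).coordNormSq_pos hu (formCoeff_ne_zero β hφ hβ hu)

/-- Evaluating the Einstein equation at b♯ gives λ b² = Ric(b♯, b♯) ≥ 0, with b² > 0. -/
theorem HasEinsteinScalar.nonneg (hβ : ∀ x : M, β.toFun x ≠ 0) (hK : IsConstantKilling a β)
    {lam : M → ℝ} (h : HasEinsteinScalar (alpha a) slit lam) (x : M) : 0 ≤ lam x := by
  have hpos := normSq_pos (a := a) hβ x
  obtain ⟨φ, hφ, u, hu, rfl, -⟩ := exists_chart_point (n := n) x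
  have h1 := (constantKillingOn_chart a β hφ hK).quad_ricciMatrix_raiseVec_nonneg hu
  rw [h.quad_ricciMatrix hφ hu, (metricOn_chart a hφ).quad_raiseVec hu,
    coordNormSq_eq_normSq a β hφ hu] at h1
  exact nonneg_of_mul_nonneg_left h1 hpos

/-- The Einstein scalar of a Kropina metric is unique. -/
theorem HasEinsteinScalar.kropina_unique (hβ : ∀ x : M, β.toFun x ≠ 0) {σ τ : M → ℝ}
    (hσ : HasEinsteinScalar (kropina a β) (posCone β) σ)
    (hτ : HasEinsteinScalar (kropina a β) (posCone β) τ) (x : M) : σ x = τ x := by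
  obtain ⟨φ, hφ, u, hu, rfl, -⟩ := exists_chart_point (n := n) x
  have hm := metricOn_chart a hφ
  have hB := hm.coordNormSq_pos hu (formCoeff_ne_zero β hφ hβ hu)
  -- At b♯ both α² and β equal b², so F = 1 there and the Einstein equation reads off the scalar.
  set V := raiseVec (metricMatrix a φ) (formCoeff β φ) u with hV
  have hbV : formCoeff β φ u ⬝ᵥ V.ofLp = _ := form_dotProduct_raiseVec
  have hVp : coordVec φ u V ∈ posCone β (φ.symm u) := by
    rw [coordVec_mem_posCone, hbV]
    exact hB
  have h1 := (hσ φ hφ u hu V hVp).symm.trans (hτ φ hφ u hu V hVp)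
  rw [inChart_kropina, localKropina, hbV, hm.quad_raiseVec hu, div_self hB.ne'] at h1
  simpa using h1

/-- Both factors have zero gradient in a chart: λ by Schur's lemma, b² because β is a constant
Killing form. A ball inside the chart then gives local constancy. -/
theorem HasEinsteinScalar.isLocallyConstant (hn : 3 ≤ n)
    (hK : IsConstantKilling a β) {lam : M → ℝ} (h : HasEinsteinScalar (alpha a) slit lam) :
    IsLocallyConstant (fun x => lam x * normSq a β x) := by
  rw [IsLocallyConstant.iff_eventually_eq]
  intro x
  obtain ⟨φ, hφ, u, hu, hux, hx, hxu⟩ := exists_chart_point (n := n) x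
  have hm := metricOn_chart a hφ
  have hk := constantKillingOn_chart a β hφ hK
  have hE : ∀ v ∈ φ.target, ∀ i j, ricciTensor (metricMatrix a φ) i j v =
      lam (φ.symm v) * metricMatrix a φ v i j := by
    intro v hv i j
    have h1 : ricciMatrix (metricMatrix a φ) v = lam (φ.symm v) • metricMatrix a φ v := by
      refine eq_of_quad_eq (hm.ricciMatrix_transpose hv) ?_ fun z => ?_
      · rw [Matrix.transpose_smul, hm.transpose_eq hv]
      · rw [h.quad_ricciMatrix hφ hv]
        simp [quad, Matrix.smul_mulVec]
    exact congrFun (congrFun h1 i) j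
  have hl := hm.smooth_einsteinScalar hE (by omega)
  obtain ⟨r, hr, hrs⟩ := Metric.isOpen_iff.1 φ.open_target u hu
  have hconst : ∀ v ∈ Metric.ball u r,
      lam (φ.symm v) * coordNormSq (metricMatrix a φ) (formCoeff β φ) v =
        lam (φ.symm u) * coordNormSq (metricMatrix a φ) (formCoeff β φ) u := by
    have hd : ∀ v ∈ Metric.ball u r, ∀ i,
        HasPd i (fun v => lam (φ.symm v) * coordNormSq (metricMatrix a φ) (formCoeff β φ) v)
          0 v := by
      intro v hv i
      refine ((hasPd_of_contDiffOn hm.isOpen hl (hrs hv) i).mul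
        (hasPd_of_contDiffOn hm.isOpen hk.smooth_coordNormSq (hrs hv) i)).congr_deriv ?_
      rw [hm.pd_einsteinScalar hE hn (hrs hv), hk.pd_coordNormSq (hrs hv)]
      ring
    exact fun v hv => eqOn_ball_of_pd_eq_zero
      (f := fun v => lam (φ.symm v) * coordNormSq (metricMatrix a φ) (formCoeff β φ) v)
      -- Differentiability is packaged with each partial derivative, so an arbitrary index is chosen
      -- to extract it; n ≥ 3 provides one.
      (fun v hv => (hd v hv ⟨0, by omega⟩).1) (fun v hv i => (hd v hv i).2) hv
  have hcont : ∀ᶠ z in nhds x, φ z ∈ Metric.ball u r :=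
    (φ.continuousAt hx).preimage_mem_nhds (by rw [hxu]; exact Metric.ball_mem_nhds u hr)
  filter_upwards [hcont, φ.open_source.mem_nhds hx] with z hz hzs
  have h1 := hconst (φ z) hz
  rw [coordNormSq_eq_normSq a β hφ (φ.map_source hzs), coordNormSq_eq_normSq a β hφ hu,
    φ.left_inv hzs, hux] at h1
  exact h1

end Einstein

end Kropina

end

/-! ### Assembly of the three claims -/

theorem theorem1p1 {n : ℕ} (hn : 2 ≤ n) {M : Type*} [TopologicalSpace M]
    [ChartedSpace (EuclideanSpace ℝ (Fin n)) M] [IsManifold (𝓡 n) ∞ M]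
    (a : Kropina.RMetric n M) (β : Kropina.OneForm n M)
    (hβ : ∀ x : M, β.toFun x ≠ 0) (hK : Kropina.IsConstantKilling a β) :
    (Kropina.IsEinstein (Kropina.kropina a β) (Kropina.posCone β) ↔
      Kropina.IsEinstein (Kropina.alpha a) Kropina.slit) ∧
    (∀ σ lam : M → ℝ,
      Kropina.HasEinsteinScalar (Kropina.kropina a β) (Kropina.posCone β) σ →
      Kropina.HasEinsteinScalar (Kropina.alpha a) Kropina.slit lam →
        ∀ x : M, σ x = (1 / 4) * lam x * Kropina.normSq a β x ∧ 0 ≤ σ x) ∧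
    (3 ≤ n → ConnectedSpace M →
      Kropina.IsEinstein (Kropina.kropina a β) (Kropina.posCone β) →
      Kropina.IsRicciConstant (Kropina.kropina a β) (Kropina.posCone β)) := by
  refine ⟨⟨fun ⟨σ, hσ⟩ => ⟨_, hσ.alpha_of_kropina hβ hK⟩,
    fun ⟨lam, hlam⟩ => ⟨_, hlam.kropina_of_alpha hK⟩⟩, ?_, ?_⟩
  -- The scalar σ is arbitrary, so it is compared by uniqueness with the scalar ¼ λ b² produced from
  -- α.
  · intro σ lam hσ hlam x
    have h1 : σ x = (1 / 4) * lam x * Kropina.normSq a β x :=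
      hσ.kropina_unique hβ (hlam.kropina_of_alpha hK) x
    refine ⟨h1, ?_⟩
    rw [h1]
    have := hlam.nonneg hβ hK x
    have := Kropina.normSq_pos (a := a) hβ x
    positivity
  · rintro hn3 hM ⟨σ, hσ⟩
    have hlam := hσ.alpha_of_kropina hβ hK
    have hF := hlam.kropina_of_alpha hK
    have hc := hlam.isLocallyConstant hn3 hK
    obtain ⟨x₀⟩ := hM.toNonempty
    -- The constant is ¼ λ b² at a base point, with λ = 4σ/b². It is left unsimplified to match the
    -- locally constant function λ b² literally.
    refine ⟨(1 / 4) * (4 * σ x₀ / Kropina.normSq a β x₀) * Kropina.normSq a β x₀, ?_⟩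
    intro φ hφ u hu y hy
    rw [hF φ hφ u hu y hy]
    have := hc.apply_eq_of_preconnectedSpace (φ.symm u) x₀
    linear_combination (1 / 4) * Kropina.inChart (Kropina.kropina a β) φ u y ^ 2 * this
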